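/- Let $\mathfrak g^\sigma$ be a simple real Lie algebra of the complex type, i.e. a finite-dimensional simple complex Lie algebra regarded as a real one. Let $\mathfrak g=\mathbb C\otimes_{\mathbb R}\mathfrak g^\sigma$ and let $\sigma$ be the conjugation of $\mathfrak g$ with respect to $\mathfrak g^\sigma$. Let $\mathfrak h$ be the complexification of a Cartan subalgebra of $\mathfrak g^\sigma$, $\mathcal R$ the root system of $(\mathfrak g,\mathfrak h)$, on which $\sigma$ acts by $\sigma(\alpha)(H)=\overline{\alpha(\sigma(H))}$, and $\mathcal B$ the set of simple roots of an $S$-chamber (the $\sigma$-conjugate of every positive root $\alpha$ with $\sigma(\alpha)\neq-\alpha$ is positive). Let $\varepsilon$ be the involution of $\mathcal B$ given by the Satake diagram: $\varepsilon(\alpha)=\alpha$ if $\sigma(\alpha)=-\alpha$, and otherwise $\sigma(\alpha)-\varepsilon(\alpha)$ is a combination, with non-negative integer coefficients, of the $\beta\in\mathcal B$ with $\sigma(\beta)=-\beta$. (Here no root satisfies $\sigma(\alpha)=-\alpha$, and $\varepsilon=\sigma|_{\mathcal B}$.) For $\phi\subseteq\mathcal B$ let $\mathfrak q=\mathfrak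 q_\phi$ be the sum of $\mathfrak h$ and of the root spaces of all roots $\beta=\sum_{\alpha\in\mathcal B}n_\alpha\alpha$ with $n_\alpha\ge 0$ for every $\alpha\in\phi$; for $\alpha\in\phi$ let $\phi^\circ(\alpha)$ be the connected component of $\alpha$ in the subdiagram $(\mathcal B\setminus\phi)\cup\{\alpha\}$ of the Dynkin diagram. Assume that $(\mathfrak g^\sigma,\mathfrak q)$ is minimal: no nonzero ideal of $\mathfrak g^\sigma$ is contained in $\mathfrak q\cap\mathfrak g^\sigma$, and $\mathfrak q\cap\mathfrak g^\sigma$ contains a maximal triangular subalgebra of $\mathfrak g^\sigma$ (a subalgebra is triangular if its adjoint action on $\mathfrak g^\sigma$ is by triangular matrices in a suitable basis). Set $\mathfrak q^{(0)}=\mathfrak q$ and $\mathfrak q^{(k)}=\{Z\in\mathfrak q^{(k-1)} : [Z,\sigma(\mathfrak q)]\subseteq\mathfrak q^{(k-1)}+\sigma(\mathfrak q)\}$ for $k\ge 1$. For $k\geq 1$ the CR algebra $(\mathfrak g^\sigma,\mathfrak q)$ is Levi $k$-nondegenerate if $\mathfrak q^{(k-1)}\supsetneq\mathfrak q^{(k)}=\mathfrak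 q\cap\sigma(\mathfrak q)$, and finitely nondegenerate if it is Levi $k$-nondegenerate for some $k\ge 1$. (a) If $(\mathfrak g^\sigma,\mathfrak q)$ is not totally real (i.e. $\mathfrak q\ne\mathfrak q\cap\sigma(\mathfrak q)$), the following are equivalent: (1) $(\mathfrak g^\sigma,\mathfrak q)$ is finitely nondegenerate; (2) $(\mathfrak g^\sigma,\mathfrak q)$ is Levi $1$-nondegenerate; (3) $\varepsilon(\phi^\circ(\alpha))\cap\phi\neq\emptyset$ for every $\alpha\in\phi$. (b) Without excluding the totally real case, (3) is equivalent to each of the following: (1') the only complex Lie subalgebra $\mathfrak q'$ of $\mathfrak g$ with $\mathfrak q\subseteq\mathfrak q'\subseteq\mathfrak q+\sigma(\mathfrak q)$ is $\mathfrak q'=\mathfrak q$; (2') for every $Z\in\mathfrak q\setminus\sigma(\mathfrak q)$ there is $Z'\in\mathfrak q$ with $[Z,\sigma(Z')]\notin\mathfrak q+\sigma(\mathfrak q)$. -/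

import Mathlib

open scoped TensorProduct

noncomputable section

namespace ParabolicCR

/-! ### Roots, simple systems and parabolic subalgebras of a complex Lie algebra -/

section Roots

variable {G : Type*} [LieRing G] [LieAlgebra ℂ G]
  (H : LieSubalgebra ℂ G) [H.IsCartanSubalgebra]

/-- `β` is a root of `(G, H)`: a nonzero linear form on the Cartan subalgebra `H` with a nonzero
root space. -/
def IsRoot (β : Module.Dual ℂ H) : Prop :=
  β ≠ 0 ∧ LieAlgebra.rootSpace H β ≠ ⊥

/-- `B` is the set of simple roots of a Weyl chamber: a linearly independent set of roots such that
every root is a combination of elements of `B` with natural coefficients, or the opposite of such a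
combination. -/
structure IsSimpleSystem (B : Set (Module.Dual ℂ H)) : Prop where
  isRoot : ∀ α ∈ B, IsRoot H α
  linearIndependent : LinearIndependent ℂ (fun α : B => (α : Module.Dual ℂ H))
  pos_or_neg : ∀ β, IsRoot H β → β ∈ AddSubmonoid.closure B ∨ -β ∈ AddSubmonoid.closure B

/-- The positive roots with respect to the simple system `B`. -/
def positiveRoots (B : Set (Module.Dual ℂ H)) : Set (Module.Dual ℂ H) :=
  {β | IsRoot H β ∧ β ∈ AddSubmonoid.closure B}

/-- The parabolic set of roots attached to a set `Φ` of simple roots: the roots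
`β = ∑_{α ∈ B} n_α α` (with integers `n_α`) such that `n_α ≥ 0` for all `α ∈ Φ`. -/
def parabolicSet (B Φ : Set (Module.Dual ℂ H)) : Set (Module.Dual ℂ H) :=
  {β | IsRoot H β ∧ ∃ n : Module.Dual ℂ H →₀ ℤ, (n.support : Set (Module.Dual ℂ H)) ⊆ B ∧
    n.sum (fun α c => c • α) = β ∧ ∀ α ∈ Φ, 0 ≤ n α}

variable {H} in
lemma add_mem_parabolicSet {B Φ : Set (Module.Dual ℂ H)} {β γ : Module.Dual ℂ H}
    (hβ : β ∈ parabolicSet H B Φ) (hγ : γ ∈ parabolicSet H B Φ) (h : IsRoot H (β + γ)) :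
    β + γ ∈ parabolicSet H B Φ := by
  classical
  obtain ⟨-, n, hn, rfl, hn0⟩ := hβ
  obtain ⟨-, m, hm, rfl, hm0⟩ := hγ
  refine ⟨h, n + m, ?_, ?_, fun α hα => ?_⟩
  · intro α hα
    have := Finsupp.support_add hα
    rcases Finset.mem_union.1 this with h1 | h1
    · exact hn h1
    · exact hm h1
  · exact Finsupp.sum_add_index' (fun _ => zero_smul _ _) (fun _ _ _ => add_smul _ _ _)
  · simpa using add_nonneg (hn0 α hα) (hm0 α hα)

variable {H} in
lemma lie_mem_parabolic_aux [IsNoetherian ℂ G] {B Φ : Set (Module.Dual ℂ H)}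
    {β γ : Module.Dual ℂ H} (hβ : β = 0 ∨ β ∈ parabolicSet H B Φ)
    (hγ : γ = 0 ∨ γ ∈ parabolicSet H B Φ) {x y : G}
    (hx : x ∈ LieAlgebra.rootSpace H β) (hy : y ∈ LieAlgebra.rootSpace H γ) :
    ⁅x, y⁆ ∈ H.toSubmodule ⊔
      ⨆ β : parabolicSet H B Φ, (LieAlgebra.rootSpace H (β : Module.Dual ℂ H)).toSubmodule := by
  have hxy : ⁅x, y⁆ ∈ LieAlgebra.rootSpace H (β + γ : Module.Dual ℂ H) :=
    LieAlgebra.lie_mem_genWeightSpace_of_mem_genWeightSpace hx hy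
  by_cases h0 : β + γ = 0
  · refine Submodule.mem_sup_left ?_
    rw [h0] at hxy
    have h1 : ⁅x, y⁆ ∈ LieAlgebra.rootSpace H (0 : H → ℂ) := hxy
    rwa [LieAlgebra.rootSpace_zero_eq] at h1
  by_cases hb : LieAlgebra.rootSpace H (β + γ : Module.Dual ℂ H) = ⊥
  · rw [hb] at hxy
    rw [(LieSubmodule.mem_bot _).1 hxy]
    exact zero_mem _
  have hmem : β + γ ∈ parabolicSet H B Φ := by
    rcases hβ with rfl | hβ
    · rcases hγ with rfl | hγ
      · simp at h0
      · simpa using hγ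
    · rcases hγ with rfl | hγ
      · simpa using hβ
      · exact add_mem_parabolicSet hβ hγ ⟨h0, hb⟩
  exact Submodule.mem_sup_right (Submodule.mem_iSup_of_mem ⟨_, hmem⟩ hxy)

/-- The parabolic subalgebra `q_Φ`: the sum of the Cartan subalgebra and of the root spaces of the
roots in `parabolicSet H B Φ`. -/
def parabolic [IsNoetherian ℂ G] (B Φ : Set (Module.Dual ℂ H)) : LieSubalgebra ℂ G where
  toSubmodule := H.toSubmodule ⊔
    ⨆ β : parabolicSet H B Φ, (LieAlgebra.rootSpace H (β : Module.Dual ℂ H)).toSubmodule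
  lie_mem' := by
    intro x y hx hy
    have hH : ∀ z ∈ H, z ∈ LieAlgebra.rootSpace H ((0 : Module.Dual ℂ H) : H → ℂ) := by
      intro z hz
      have h1 : z ∈ LieAlgebra.rootSpace H (0 : H → ℂ) := by
        rwa [LieAlgebra.rootSpace_zero_eq]
      exact h1
    have key : ∀ {γ : Module.Dual ℂ H}, (γ = 0 ∨ γ ∈ parabolicSet H B Φ) → ∀ {v : G},
        v ∈ LieAlgebra.rootSpace H γ → ∀ {u : G}, u ∈ H.toSubmodule ⊔
          ⨆ β : parabolicSet H B Φ, (LieAlgebra.rootSpace H (β : Module.Dual ℂ H)).toSubmodule →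
        ⁅u, v⁆ ∈ H.toSubmodule ⊔
          ⨆ β : parabolicSet H B Φ, (LieAlgebra.rootSpace H (β : Module.Dual ℂ H)).toSubmodule := by
      intro γ hγ v hv u hu
      obtain ⟨u1, h1, u2, h2, rfl⟩ := Submodule.mem_sup.1 hu
      rw [add_lie]
      clear hu
      refine add_mem (lie_mem_parabolic_aux (Or.inl rfl) hγ (hH _ h1) hv) ?_
      induction h2 using Submodule.iSup_induction' with
      | mem β w hw => exact lie_mem_parabolic_aux (Or.inr β.2) hγ hw hv
      | zero => simp
      | add a b _ _ ha hb =>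
        rw [add_lie]
        exact add_mem ha hb
    obtain ⟨y1, h1, y2, h2, rfl⟩ := Submodule.mem_sup.1 hy
    rw [lie_add]
    clear hy
    refine add_mem (key (Or.inl rfl) (hH _ h1) hx) ?_
    induction h2 using Submodule.iSup_induction' with
    | mem β w hw => exact key (Or.inr β.2) hw hx
    | zero => simp
    | add a b _ _ ha hb =>
      rw [lie_add]
      exact add_mem ha hb

/-- The Dynkin diagram as a graph (the multiplicities and directions of its edges play no role
here): two different simple roots are joined if and only if they are not orthogonal, that is, if
and only if their sum is a root. -/
def dynkinGraph : SimpleGraph (Module.Dual ℂ H) where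
  Adj α β := α ≠ β ∧ IsRoot H (α + β)
  symm := ⟨fun α β h => ⟨h.1.symm, by rw [add_comm]; exact h.2⟩⟩
  loopless := ⟨fun _ h => h.1 rfl⟩

/-- The connected component of `α` in the subdiagram `(B ∖ Φ) ∪ {α}` of the Dynkin diagram. -/
def component (B Φ : Set (Module.Dual ℂ H)) (α : Module.Dual ℂ H) : Set (Module.Dual ℂ H) :=
  {β | ∃ (hα : α ∈ B \ Φ ∪ {α}) (hβ : β ∈ B \ Φ ∪ {α}),
    ((dynkinGraph H).induce (B \ Φ ∪ {α})).Reachable ⟨α, hα⟩ ⟨β, hβ⟩}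

end Roots

/-! ### Real Lie algebras, their complexifications and CR algebras -/

section CRAlgebras

/-- A real Lie algebra is *simple of the complex type* if it is obtained from a simple complex Lie
algebra by restriction of scalars from `ℂ` to `ℝ`. -/
def IsSimpleOfComplexType (L : Type*) [LieRing L] [i : LieAlgebra ℝ L] : Prop :=
  ∃ j : LieAlgebra ℂ L, (∀ (r : ℝ) (x : L), j.smul (r : ℂ) x = i.smul r x) ∧
    @LieAlgebra.IsSimple ℂ L _ _ j

variable {L : Type*} [LieRing L] [LieAlgebra ℝ L]

variable (L) in
/-- The conjugation `σ` of the complexification `ℂ ⊗ L` with respect to its real form `L`: the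
antilinear map with `σ (z ⊗ x) = conj z ⊗ x`. -/
def conj : (ℂ ⊗[ℝ] L) →ₛₗ[starRingEnd ℂ] (ℂ ⊗[ℝ] L) where
  toFun := LinearMap.rTensor L Complex.conjAe.toLinearMap
  map_add' := map_add _
  map_smul' z x := by
    induction x with
    | zero => simp
    | tmul w x => simp [TensorProduct.smul_tmul']
    | add x y hx hy => simp only [smul_add, map_add, hx, hy]

@[simp]
lemma conj_tmul (z : ℂ) (x : L) : conj L (z ⊗ₜ[ℝ] x) = (starRingEnd ℂ z) ⊗ₜ[ℝ] x := rfl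

/-- The complex subspace `σ(q)`. -/
def conjSub (q : LieSubalgebra ℂ (ℂ ⊗[ℝ] L)) : Submodule ℂ (ℂ ⊗[ℝ] L) :=
  q.toSubmodule.map (conj L)

/-- The CR algebra `(L, q)` is totally real: `q = q ∩ σ(q)`. -/
def IsTotallyReal (q : LieSubalgebra ℂ (ℂ ⊗[ℝ] L)) : Prop :=
  q.toSubmodule = q.toSubmodule ⊓ conjSub q

/-- The isotropy subalgebra `q ∩ L` of the CR algebra `(L, q)`. -/
def isotropy (q : LieSubalgebra ℂ (ℂ ⊗[ℝ] L)) : LieSubalgebra ℝ L where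
  carrier := {x | (1 : ℂ) ⊗ₜ[ℝ] x ∈ q}
  add_mem' {x y} hx hy := by
    simpa only [Set.mem_ofPred_eq, TensorProduct.tmul_add] using add_mem hx hy
  zero_mem' := by simp
  smul_mem' r x hx := by
    have h : (1 : ℂ) ⊗ₜ[ℝ] (r • x) = (r : ℂ) • ((1 : ℂ) ⊗ₜ[ℝ] x) := by
      rw [TensorProduct.smul_tmul', ← TensorProduct.smul_tmul]; simp
    simpa only [Set.mem_ofPred_eq, h] using q.smul_mem (r : ℂ) hx
  lie_mem' {x y} hx hy := by
    simpa using q.lie_mem hx hy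

/-- The CR algebra `(L, q)` is effective: no nonzero ideal of `L` is contained in `q ∩ L`. -/
def IsEffective (q : LieSubalgebra ℂ (ℂ ⊗[ℝ] L)) : Prop :=
  ∀ I : LieIdeal ℝ L, (∀ x ∈ I, x ∈ isotropy q) → I = ⊥

/-- A subalgebra `t` of `L` is triangular if, in a suitable basis of `L`, all the maps `ad X`,
`X ∈ t`, are represented by (upper) triangular matrices. -/
def IsTriangular (t : LieSubalgebra ℝ L) : Prop :=
  ∃ (n : ℕ) (b : Module.Basis (Fin n) ℝ L),
    ∀ X ∈ t, (LinearMap.toMatrix b b (LieAlgebra.ad ℝ L X)).BlockTriangular id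

/-- A `t`-subalgebra is a subalgebra that contains a maximal triangular subalgebra. -/
def IsTSubalgebra (s : LieSubalgebra ℝ L) : Prop :=
  ∃ t : LieSubalgebra ℝ L, Maximal IsTriangular t ∧ t ≤ s

/-- The CR algebra `(L, q)` is minimal: it is effective and its isotropy subalgebra is a
`t`-subalgebra. -/
def IsMinimal (q : LieSubalgebra ℂ (ℂ ⊗[ℝ] L)) : Prop :=
  IsEffective q ∧ IsTSubalgebra (isotropy q)

/-- The descending chain `q⁽⁰⁾ = q`,
`q⁽ᵏ⁺¹⁾ = {Z ∈ q⁽ᵏ⁾ | [Z, σ(q)] ⊆ q⁽ᵏ⁾ + σ(q)}`. -/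
def leviChain (q : LieSubalgebra ℂ (ℂ ⊗[ℝ] L)) : ℕ → Submodule ℂ (ℂ ⊗[ℝ] L)
  | 0 => q.toSubmodule
  | k + 1 =>
    { carrier := {Z | Z ∈ leviChain q k ∧ ∀ W ∈ conjSub q, ⁅Z, W⁆ ∈ leviChain q k ⊔ conjSub q}
      add_mem' := fun ha hb => ⟨add_mem ha.1 hb.1, fun W hW => by
        rw [add_lie]; exact add_mem (ha.2 W hW) (hb.2 W hW)⟩
      zero_mem' := ⟨zero_mem _, fun W _ => by rw [zero_lie]; exact zero_mem _⟩
      smul_mem' := fun c a ha => ⟨Submodule.smul_mem _ c ha.1, fun W hW => by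
        rw [smul_lie]; exact Submodule.smul_mem _ c (ha.2 W hW)⟩ }

/-- The CR algebra `(L, q)` is (Levi) `k`-nondegenerate: `k ≥ 1` and
`q⁽ᵏ⁻¹⁾ ⊋ q⁽ᵏ⁾ = q ∩ σ(q)`. -/
def IsLeviNondegenerate (q : LieSubalgebra ℂ (ℂ ⊗[ℝ] L)) (k : ℕ) : Prop :=
  1 ≤ k ∧ leviChain q k < leviChain q (k - 1) ∧ leviChain q k = q.toSubmodule ⊓ conjSub q

/-- The CR algebra `(L, q)` is finitely nondegenerate: it is `k`-nondegenerate for some `k`. -/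
def IsFinitelyNondegenerate (q : LieSubalgebra ℂ (ℂ ⊗[ℝ] L)) : Prop :=
  ∃ k : ℕ, IsLeviNondegenerate q k

/-- The formulation of finite nondegeneracy by intermediate subalgebras: `q` is the only complex
subalgebra `q'` with `q ⊆ q' ⊆ q + σ(q)`. It also holds for totally real CR algebras. -/
def IsFinitelyNondegenerate' (q : LieSubalgebra ℂ (ℂ ⊗[ℝ] L)) : Prop :=
  ∀ q' : LieSubalgebra ℂ (ℂ ⊗[ℝ] L), q ≤ q' → q'.toSubmodule ≤ q.toSubmodule ⊔ conjSub q → q' = q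

/-- The formulation of 1-nondegeneracy by the Levi form: for each `Z ∈ q ∖ σ(q)` there is `Z' ∈ q`
with `[Z, σ(Z')] ∉ q + σ(q)`. It also holds for totally real CR algebras. -/
def IsLeviOneNondegenerate' (q : LieSubalgebra ℂ (ℂ ⊗[ℝ] L)) : Prop :=
  ∀ Z ∈ q, Z ∉ conjSub q → ∃ Z' ∈ q, ⁅Z, conj L Z'⁆ ∉ q.toSubmodule ⊔ conjSub q

end CRAlgebras

/-! ### The action of the conjugation on roots; Satake diagrams -/

section Satake

variable {L : Type*} [LieRing L] [LieAlgebra ℝ L]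
  (H : LieSubalgebra ℂ (ℂ ⊗[ℝ] L))

/-- `H` is stable under the conjugation, that is, it is the complexification of a subalgebra
of `L`. -/
def IsConjStable : Prop := ∀ x ∈ H, conj L x ∈ H

variable {H} (hH : IsConjStable H)

/-- The action of the conjugation on linear forms on `H`: `σ(α)(x) = conj (α (σ x))`. -/
def conjDual (α : Module.Dual ℂ H) : Module.Dual ℂ H where
  toFun x := starRingEnd ℂ (α ⟨conj L x, hH x x.2⟩)
  map_add' x y := by
    rw [← map_add, ← map_add]
    congr 2
    ext
    simp
  map_smul' c x := by
    have : (⟨conj L (c • x : H), hH _ (c • x).2⟩ : H)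
        = (starRingEnd ℂ c) • ⟨conj L x, hH x x.2⟩ := by
      ext
      simp
    rw [this, map_smul, smul_eq_mul, map_mul, Complex.conj_conj, RingHom.id_apply, smul_eq_mul]

/-- A root `α` is imaginary if `σ(α) = -α`. -/
def IsImaginary (α : Module.Dual ℂ H) : Prop := conjDual hH α = -α

/-- The relation `ε(α) = β` between simple roots `α, β ∈ B`, where `ε` is the involution of the
Satake diagram: it fixes the black (imaginary) simple roots, and
`σ(α) = ε(α) + ∑ n_γ γ`, with natural coefficients `n_γ` and with `γ` ranging over the black simple
roots, if `α` is not black. -/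
def SatakeInvolution (B : Set (Module.Dual ℂ H)) (α β : Module.Dual ℂ H) : Prop :=
  α ∈ B ∧ β ∈ B ∧ ((IsImaginary hH α ∧ β = α) ∨ (¬ IsImaginary hH α ∧ ¬ IsImaginary hH β ∧
    conjDual hH α - β ∈ AddSubmonoid.closure {γ ∈ B | IsImaginary hH γ}))

variable [H.IsCartanSubalgebra]

/-- `B` is the simple system of an `S`-chamber: the conjugate of a positive root that is not
imaginary is again positive. -/
def IsSChamber (B : Set (Module.Dual ℂ H)) : Prop :=
  ∀ α ∈ positiveRoots H B, ¬ IsImaginary hH α → conjDual hH α ∈ positiveRoots H B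

end Satake

end ParabolicCR

end

open scoped TensorProduct

noncomputable section

namespace ParabolicCR

/-! ### Semisimplicity of the complexification. -/

section Killing

variable {L : Type*} [LieRing L] [LieAlgebra ℝ L]

/-! Write σ for the conjugation. Multiplication by i on the real algebra extends to a ℂ-linear map J
of the complexification commuting with σ and with all ad X. It acts on each root space by i or by
-i, and σ interchanges the two kinds of roots, so no root is imaginary
(`IsSimpleOfComplexType.not_isImaginary`). Hence σ maps positive roots to positive roots; being an
involution, it preserves heights and permutes the simple roots (`conjDual_mem`). Thus ε = σ on B and
σ(q_Φ) = q_{σΦ}, which makes the problem one about roots.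

If σ(φ°(α)) misses Φ, then φ°(α) misses σΦ. The roots of q_{Φ∖{α}} that are not in q_Φ are negative,
with connected support inside φ°(α); so they are roots of σ(q), and q_{Φ∖{α}} violates (1').

Conversely, let (3) hold and let Z in q∖σ(q) have a nonzero component in the root space of α, with α
not a root of σ(q). Then -α is positive, has coefficient zero on Φ and contains some σ(d), d ∈ Φ.
Applying σ to (3) gives a path from σ(d) to some b ∈ Φ that meets σΦ at most in σ(d). Growing -α
along it (`IsSimpleSystem.exists_isRoot_add`) yields a positive root μ, zero on σΦ and positive at
b, with -α + μ a root. Bracketing Z with a vector of root -μ, which lies in σ(q), gives a component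
of root α - μ: it is outside q because of b and outside σ(q) because of σ(d). This is (2').

The remaining links hold for any subalgebra q: (2') gives q⁽¹⁾ = q ∩ σ(q), and q⁽ᵏ⁾ = q ∩ σ(q) for
some k gives (1') (`isFinitelyNondegenerate'_of_leviChain`). -/

lemma IsSimpleOfComplexType.hasTrivialRadical [FiniteDimensional ℝ L]
    (hL : IsSimpleOfComplexType L) : LieAlgebra.HasTrivialRadical ℝ L := by
  obtain ⟨j, hj, hs⟩ := hL
  have : IsScalarTower ℝ ℂ L := ⟨fun r z x => by
    have hr : ∀ y : L, r • y = (r : ℂ) • y := fun y => (hj r y).symm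
    rw [hr, show r • z = (r : ℂ) * z from rfl, mul_smul]⟩
  have : LieAlgebra.HasTrivialRadical ℂ L := inferInstance
  rw [LieAlgebra.hasTrivialRadical_iff_no_abelian_ideals]
  intro I hI
  have habel : ∀ x ∈ I, ∀ y ∈ I, ⁅x, y⁆ = 0 := fun x hx y hy => by
    have := hI.trivial ⟨x, hx⟩ ⟨y, hy⟩
    exact congrArg Subtype.val this
  -- The bracket is ℂ-bilinear, so the complex span of a real abelian ideal is an abelian ideal of
  -- the complex algebra, hence zero.
  let K : LieIdeal ℂ L :=
    { Submodule.span ℂ (I : Set L) with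
      lie_mem := by
        intro x m hm
        change m ∈ Submodule.span ℂ (I : Set L) at hm
        change ⁅x, m⁆ ∈ Submodule.span ℂ (I : Set L)
        induction hm using Submodule.span_induction with
        | mem y hy => exact Submodule.subset_span (I.lie_mem hy)
        | zero => simp
        | add y z _ _ h1 h2 => rw [lie_add]; exact add_mem h1 h2
        | smul c y _ h => rw [lie_smul]; exact Submodule.smul_mem _ c h }
  have hK : IsLieAbelian K := ⟨fun ⟨x, hx⟩ ⟨y, hy⟩ => by
    apply Subtype.ext
    change ⁅x, y⁆ = 0
    change x ∈ Submodule.span ℂ (I : Set L) at hx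
    change y ∈ Submodule.span ℂ (I : Set L) at hy
    induction hx using Submodule.span_induction with
    | mem x hx =>
      induction hy using Submodule.span_induction with
      | mem y hy => exact habel x hx y hy
      | zero => simp
      | add y z _ _ h1 h2 => rw [lie_add, h1, h2, add_zero]
      | smul c y _ h => rw [lie_smul, h, smul_zero]
    | zero => simp
    | add u v _ _ h1 h2 => rw [add_lie, h1, h2, add_zero]
    | smul c u _ h => rw [smul_lie, h, smul_zero]⟩
  have hK0 : K = ⊥ := (LieAlgebra.hasTrivialRadical_iff_no_abelian_ideals ℂ L).1 this K hK
  rw [LieSubmodule.eq_bot_iff]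
  intro x hx
  have : x ∈ K := Submodule.subset_span (s := (I : Set L)) hx
  rw [hK0] at this
  exact this

/-- Every element of the complexification is `1 ⊗ x + i ⊗ y`. -/
lemma exists_eq_one_tmul_add_I_tmul (Z : ℂ ⊗[ℝ] L) :
    ∃ x y : L, Z = (1 : ℂ) ⊗ₜ[ℝ] x + Complex.I ⊗ₜ[ℝ] y := by
  induction Z with
  | zero => exact ⟨0, 0, by simp⟩
  | tmul w x =>
    refine ⟨w.re • x, w.im • x, ?_⟩
    rw [← TensorProduct.smul_tmul, ← TensorProduct.smul_tmul, ← TensorProduct.add_tmul]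
    congr 1
    apply Complex.ext <;> simp
  | add a b ha hb =>
    obtain ⟨x, y, rfl⟩ := ha
    obtain ⟨x', y', rfl⟩ := hb
    exact ⟨x + x', y + y', by simp only [TensorProduct.tmul_add]; abel⟩

lemma killingForm_tmul [FiniteDimensional ℝ L] (a b : ℂ) (x y : L) :
    killingForm ℂ (ℂ ⊗[ℝ] L) (a ⊗ₜ x) (b ⊗ₜ y) = a * b * (killingForm ℝ L x y : ℂ) := by
  rw [killingForm_apply_apply, killingForm_apply_apply]
  have key : ∀ (a : ℂ) (x : L), LieAlgebra.ad ℂ (ℂ ⊗[ℝ] L) (a ⊗ₜ x)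
      = a • (LieAlgebra.ad ℝ L x).baseChange ℂ := by
    intro a x
    apply LinearMap.ext
    intro z
    induction z with
    | zero => simp
    | tmul w y => simp [TensorProduct.smul_tmul']
    | add u v hu hv => rw [map_add, map_add, hu, hv]
  rw [key, key, LinearMap.smul_comp, LinearMap.comp_smul, ← LinearMap.baseChange_comp, map_smul,
    map_smul, LinearMap.trace_baseChange]
  simp [mul_assoc]

/-- The Killing form is real on the real form, so the real and imaginary parts of an element of its
radical lie in the radical of the real Killing form. -/
lemma isKilling_complexification [FiniteDimensional ℝ L] [LieAlgebra.IsKilling ℝ L] :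
    LieAlgebra.IsKilling ℂ (ℂ ⊗[ℝ] L) := by
  refine ⟨(LieSubmodule.eq_bot_iff _).2 fun Z hZ => ?_⟩
  obtain ⟨x, y, rfl⟩ := exists_eq_one_tmul_add_I_tmul Z
  have h : ∀ w : L, killingForm ℝ L w x = 0 ∧ killingForm ℝ L w y = 0 := by
    intro w
    have := (LieIdeal.mem_killingCompl ℂ _ _).1 hZ ((1 : ℂ) ⊗ₜ w) trivial
    change killingForm ℂ (ℂ ⊗[ℝ] L) _ _ = 0 at this
    rw [map_add, killingForm_tmul, killingForm_tmul] at this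
    have h1 := congrArg Complex.re this
    have h2 := congrArg Complex.im this
    simp at h1 h2
    exact ⟨h1, h2⟩
  have hk : ∀ u : L, (∀ w, killingForm ℝ L w u = 0) → u = 0 :=
    (LieAlgebra.IsKilling.killingForm_nondegenerate ℝ L).2
  rw [hk x fun w => (h w).1, hk y fun w => (h w).2]
  simp

end Killing

/-! ### Root strings and brackets of root spaces. -/

section KillingRoots

open LieAlgebra LieAlgebra.IsKilling LieModule

variable {G : Type*} [LieRing G] [LieAlgebra ℂ G]
  {H : LieSubalgebra ℂ G} [H.IsCartanSubalgebra] {α β γ : Module.Dual ℂ H}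

/-- The weight defined by a root. -/
def IsRoot.weight (hβ : IsRoot H β) : Weight ℂ H G := ⟨β, hβ.2⟩

lemma IsRoot.weight_apply (hβ : IsRoot H β) (h : H) : hβ.weight h = β h := rfl

lemma IsRoot.coe_weight (hβ : IsRoot H β) : (hβ.weight : H → ℂ) = β := rfl

lemma IsRoot.isNonZero_weight (hβ : IsRoot H β) : hβ.weight.IsNonZero := fun h =>
  hβ.1 (LinearMap.ext fun x => congrFun (h : (hβ.weight : H → ℂ) = 0) x)

lemma IsRoot.exists_ne_zero (hβ : IsRoot H β) : ∃ x ∈ rootSpace H β, x ≠ 0 :=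
  hβ.weight.exists_ne_zero

lemma isRoot_of_mem (h0 : β ≠ 0) {x : G} (hx : x ∈ rootSpace H β) (hx0 : x ≠ 0) : IsRoot H β :=
  ⟨h0, fun h => hx0 (by rw [h] at hx; exact hx)⟩

lemma lie_mem_rootSpace_add {x y : G} (hx : x ∈ rootSpace H α) (hy : y ∈ rootSpace H β) :
    ⁅x, y⁆ ∈ rootSpace H (α + β : Module.Dual ℂ H) :=
  lie_mem_genWeightSpace_of_mem_genWeightSpace hx hy

lemma mem_rootSpace_of_forall_lie {x : G} (hx : ∀ h : H, ⁅(h : G), x⁆ = β h • x) :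
    x ∈ rootSpace H β :=
  weightSpace_le_genWeightSpace G β ((mem_weightSpace β x).2 hx)

variable [FiniteDimensional ℂ G] [IsKilling ℂ G]

lemma IsRoot.lie_eq_smul {x : G} (hx : x ∈ rootSpace H β) (h : H) : ⁅(h : G), x⁆ = β h • x :=
  lie_eq_smul_of_mem_rootSpace hx h

lemma IsRoot.exists_smul_eq (hβ : IsRoot H β) {x y : G} (hx : x ∈ rootSpace H β) (hx0 : x ≠ 0)
    (hy : y ∈ rootSpace H β) : ∃ c : ℂ, c • x = y := by
  have h1 := finrank_rootSpace_eq_one hβ.weight hβ.isNonZero_weight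
  obtain ⟨c, hc⟩ := (finrank_eq_one_iff_of_nonzero' (⟨x, hx⟩ : rootSpace H β)
    (by simpa [Subtype.ext_iff] using hx0)).1 h1 ⟨y, hy⟩
  exact ⟨c, congrArg Subtype.val hc⟩

lemma IsRoot.neg (hβ : IsRoot H β) : IsRoot H (-β) :=
  ⟨neg_ne_zero.2 hβ.1, (-hβ.weight).2⟩

lemma isRoot_neg_iff : IsRoot H (-β) ↔ IsRoot H β :=
  ⟨fun h => by simpa using h.neg, IsRoot.neg⟩

/-- Evaluation at the coroot of `γ`: it is integral on roots, and its sign decides whether `β - γ`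
and `β + γ` are roots. -/
lemma IsRoot.exists_coroot (hγ : IsRoot H γ) : ∃ h : H, γ h = 2 ∧ ∀ β, IsRoot H β → ∃ z : ℤ,
    β h = z ∧ (0 < z → β ≠ γ → IsRoot H (β - γ)) ∧ (z < 0 → β ≠ -γ → IsRoot H (β + γ)) ∧
      (¬ IsRoot H (β - γ) → IsRoot H (β + γ) → z < 0) := by
  refine ⟨coroot hγ.weight, root_apply_coroot hγ.isNonZero_weight, fun β hβ =>
    ⟨chainBotCoeff hγ.weight hβ.weight - chainTopCoeff hγ.weight hβ.weight,
      apply_coroot_eq_cast hγ.weight hβ.weight, ?_⟩⟩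
  -- Both β - γ and β + γ lie on the γ-line through β, so each is decided by one of the two chain
  -- lengths whose difference is the value on the coroot.
  have hm := rootSpace_zsmul_add_ne_bot_iff hγ.weight hβ.weight hγ.isNonZero_weight (-1)
  have hp := rootSpace_zsmul_add_ne_bot_iff hγ.weight hβ.weight hγ.isNonZero_weight 1
  have em : ((-1 : ℤ) • hγ.weight + hβ.weight : H → ℂ) = (β - γ : Module.Dual ℂ H) := by
    ext h; simp [IsRoot.weight_apply]; ring
  have ep : ((1 : ℤ) • hγ.weight + hβ.weight : H → ℂ) = (β + γ : Module.Dual ℂ H) := by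
    ext h; simp [IsRoot.weight_apply]; ring
  rw [em] at hm
  rw [ep] at hp
  refine ⟨fun hz hne => ⟨sub_ne_zero.2 hne, hm.2 (by lia)⟩,
    fun hz hne => ⟨fun h => hne (eq_neg_of_add_eq_zero_left h), hp.2 (by lia)⟩, fun h1 h2 => ?_⟩
  have h3 := hp.1 h2.2
  -- The string criterion also counts the zero weight β - γ; in that case β + γ = 2β is not a root.
  by_cases hne : β = γ
  · subst hne
    refine absurd ?_ h2.2
    have h4 := rootSpace_two_smul hβ.weight hβ.isNonZero_weight
    rw [two_smul] at h4
    exact h4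
  · have h4 : ¬ (-1 ≤ (chainTopCoeff hγ.weight hβ.weight : ℤ) ∧
        - -1 ≤ (chainBotCoeff hγ.weight hβ.weight : ℤ)) :=
      fun h => h1 ⟨sub_ne_zero.2 hne, hm.2 h⟩
    lia

/-- The α-string through β is a module over the sl₂ of α. With v at its top, f^(k+1) v spans the
root space of β, and e f^(k+1) v = (k+1)(n-k) f^k v is nonzero because k < n. -/
lemma lie_ne_zero_of_isRoot_add (hα : IsRoot H α) (hβ : IsRoot H β) (hαβ : IsRoot H (α + β))
    {x y : G} (hx : x ∈ rootSpace H α) (hx0 : x ≠ 0) (hy : y ∈ rootSpace H β) (hy0 : y ≠ 0) :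
    ⁅x, y⁆ ≠ 0 := by
  obtain ⟨h, e, f, t, he, hf⟩ := exists_isSl2Triple_of_weight_isNonZero hα.isNonZero_weight
  obtain rfl := t.h_eq_coroot hα.isNonZero_weight he hf
  obtain ⟨v, hv, hv0⟩ := (chainTop hα.weight hβ.weight).exists_ne_zero
  set n := chainLength hα.weight hβ.weight with hn
  set p := chainTopCoeff hα.weight hβ.weight with hp
  have prim : t.HasPrimitiveVectorWith v (n : ℂ) :=
    have := lie_mem_genWeightSpace_of_mem_genWeightSpace he hv
    ⟨hv0, (chainLength_smul _ _ hv).symm, by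
      rwa [genWeightSpace_add_chainTop _ _ hα.isNonZero_weight] at this⟩
  have hp1 : 1 ≤ p := by
    have hp' := rootSpace_zsmul_add_ne_bot_iff hα.weight hβ.weight hα.isNonZero_weight 1
    have ep : ((1 : ℤ) • hα.weight + hβ.weight : H → ℂ) = (α + β : Module.Dual ℂ H) := by
      ext h; simp [IsRoot.weight_apply]
    rw [ep] at hp'
    have := (hp'.1 hαβ.2).1
    lia
  have hpn : p ≤ n := chainTopCoeff_le_chainLength _ _
  obtain ⟨k, hk⟩ : ∃ k, p = k + 1 := ⟨p - 1, by lia⟩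
  have hmem : ((toEnd ℂ G G f) ^ (k + 1)) v ∈ rootSpace H β := by
    have h1 := toEnd_pow_apply_mem hf hv (k + 1)
    have h2 : (k + 1) • (-hα.weight : H → ℂ) + chainTop hα.weight hβ.weight = β := by
      rw [coe_chainTop, ← hp, hk, ← hβ.coe_weight]
      ext h
      simp
    rwa [h2] at h1
  have hne : ⁅e, ((toEnd ℂ G G f) ^ (k + 1)) v⁆ ≠ 0 := by
    rw [prim.lie_e_pow_succ_toEnd_f]
    refine smul_ne_zero (mul_ne_zero (by exact_mod_cast Nat.succ_ne_zero k) ?_)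
      (prim.pow_toEnd_f_ne_zero_of_eq_nat rfl (by lia))
    rw [sub_ne_zero]
    exact_mod_cast (by lia : n ≠ k)
  obtain ⟨c, rfl⟩ := hα.exists_smul_eq hx hx0 he
  obtain ⟨d, hd⟩ := hβ.exists_smul_eq hy hy0 hmem
  intro h0
  rw [← hd, smul_lie, lie_smul, h0, smul_zero, smul_zero] at hne
  exact hne rfl

/-- If `α`, `β`, `γ`, `α + β` and `α + β + γ` are roots, then `γ` can be added to `α` or to `β`. -/
lemma IsRoot.add_or_add (hα : IsRoot H α) (hβ : IsRoot H β) (hγ : IsRoot H γ)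
    (hαβ : IsRoot H (α + β)) (h : IsRoot H (α + β + γ)) (h1 : α + γ ≠ 0) (h2 : β + γ ≠ 0) :
    IsRoot H (α + γ) ∨ IsRoot H (β + γ) := by
  by_contra! hcon
  obtain ⟨x, hx, hx0⟩ := hα.exists_ne_zero
  obtain ⟨y, hy, hy0⟩ := hβ.exists_ne_zero
  obtain ⟨z, hz, hz0⟩ := hγ.exists_ne_zero
  have hxz : ⁅x, z⁆ = 0 := by
    by_contra h0
    exact hcon.1 (isRoot_of_mem h1 (lie_mem_rootSpace_add hx hz) h0)
  have hyz : ⁅y, z⁆ = 0 := by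
    by_contra h0
    exact hcon.2 (isRoot_of_mem h2 (lie_mem_rootSpace_add hy hz) h0)
  have hxy := lie_ne_zero_of_isRoot_add hα hβ hαβ hx hx0 hy hy0
  refine lie_ne_zero_of_isRoot_add hαβ hγ h (lie_mem_rootSpace_add hx hy) hxy hz hz0 ?_
  -- Jacobi: ⁅⁅x, y⁆, z⁆ would vanish because ⁅x, z⁆ and ⁅y, z⁆ do.
  rw [lie_lie, hxz, hyz, lie_zero, lie_zero, sub_zero]

end KillingRoots

/-! ### Coordinates, supports and growth of positive roots. -/

section SimpleSystems

variable {G : Type*} [LieRing G] [LieAlgebra ℂ G]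
  {H : LieSubalgebra ℂ G} [H.IsCartanSubalgebra] {B Φ : Set (Module.Dual ℂ H)}
  {α β γ δ b : Module.Dual ℂ H}

/-- An additive function on the dual of the Cartan subalgebra with prescribed values on the simple
roots. -/
def IsSimpleSystem.functional (hB : IsSimpleSystem H B) (f : Module.Dual ℂ H → ℝ) :
    Module.Dual ℂ H →+ ℝ :=
  -- B is completed to a basis of the dual; taking real parts gives ordered values.
  Complex.reLm.toAddMonoidHom.comp
    ((Module.Basis.extend (show LinearIndepOn ℂ id B from hB.linearIndependent)).constr ℂ
      (fun i => ((f i : ℝ) : ℂ))).toAddMonoidHom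

lemma IsSimpleSystem.functional_apply (hB : IsSimpleSystem H B) (f : Module.Dual ℂ H → ℝ)
    (hb : b ∈ B) : hB.functional f b = f b := by
  have hli : LinearIndepOn ℂ id B := hB.linearIndependent
  have h1 : b ∈ hli.extend (Set.subset_univ B) := hli.subset_extend _ hb
  have h2 := (Module.Basis.extend hli).constr_basis ℂ (fun i => ((f i : ℝ) : ℂ)) ⟨b, h1⟩
  rw [Module.Basis.extend_apply_self] at h2
  exact congrArg Complex.re h2

/-- The coordinate of a linear form with respect to the simple root `b`. -/
def IsSimpleSystem.coord (hB : IsSimpleSystem H B) (b : Module.Dual ℂ H) :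
    Module.Dual ℂ H →+ ℝ :=
  hB.functional (Set.indicator {b} 1)

lemma IsSimpleSystem.coord_self (hB : IsSimpleSystem H B) (hb : b ∈ B) : hB.coord b b = 1 := by
  rw [IsSimpleSystem.coord, hB.functional_apply _ hb, Set.indicator_of_mem (Set.mem_singleton b), Pi.one_apply]

lemma IsSimpleSystem.coord_of_ne (hB : IsSimpleSystem H B) (hγ : γ ∈ B) (h : γ ≠ b) :
    hB.coord b γ = 0 := by
  rw [IsSimpleSystem.coord, hB.functional_apply _ hγ, Set.indicator_of_notMem (s := {b}) h]

/-- The height, extended to all linear forms. -/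
def IsSimpleSystem.height (hB : IsSimpleSystem H B) : Module.Dual ℂ H →+ ℝ :=
  hB.functional 1

lemma IsSimpleSystem.height_apply (hB : IsSimpleSystem H B) (hb : b ∈ B) : hB.height b = 1 :=
  hB.functional_apply _ hb

lemma IsSimpleSystem.functional_nonneg (hB : IsSimpleSystem H B) {f : Module.Dual ℂ H → ℝ}
    (hf : 0 ≤ f) (hβ : β ∈ AddSubmonoid.closure B) : 0 ≤ hB.functional f β := by
  induction hβ using AddSubmonoid.closure_induction with
  | mem x hx => rw [hB.functional_apply f hx]; exact hf x
  | zero => simp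
  | add x y _ _ hx hy => rw [map_add]; exact add_nonneg hx hy

lemma IsSimpleSystem.coord_nonneg (hB : IsSimpleSystem H B) (hβ : β ∈ AddSubmonoid.closure B) :
    0 ≤ hB.coord b β :=
  hB.functional_nonneg (Set.indicator_nonneg fun _ _ => zero_le_one) hβ

lemma IsSimpleSystem.exists_repr (hB : IsSimpleSystem H B) (hβ : β ∈ AddSubmonoid.closure B) :
    ∃ n : Module.Dual ℂ H →₀ ℕ, (n.support : Set (Module.Dual ℂ H)) ⊆ B ∧
      n.sum (fun α c => c • α) = β ∧ ∀ b ∈ B, hB.coord b β = n b := by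
  classical
  induction hβ using AddSubmonoid.closure_induction with
  | mem x hx =>
    refine ⟨Finsupp.single x 1, ?_, by simp, fun b hb => ?_⟩
    · rw [Finsupp.support_single _ one_ne_zero]; simpa using hx
    · by_cases h : x = b
      · subst h; rw [hB.coord_self hx]; simp
      · rw [hB.coord_of_ne hx h, Finsupp.single_eq_of_ne (Ne.symm h)]; simp
  | zero => exact ⟨0, by simp, by simp, by simp⟩
  | add x y _ _ hx hy =>
    obtain ⟨n, hn, rfl, hn'⟩ := hx
    obtain ⟨m, hm, rfl, hm'⟩ := hy
    refine ⟨n + m, ?_, Finsupp.sum_add_index' (fun _ => zero_smul _ _) (fun _ _ _ => add_smul _ _ _),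
      fun b hb => ?_⟩
    · intro a ha
      rcases Finset.mem_union.1 (Finsupp.support_add ha) with h | h
      exacts [hn h, hm h]
    · rw [map_add, hn' b hb, hm' b hb]; simp

lemma IsSimpleSystem.eq_zero_of_coord (hB : IsSimpleSystem H B)
    (hβ : β ∈ AddSubmonoid.closure B) (h : ∀ b ∈ B, hB.coord b β = 0) : β = 0 := by
  obtain ⟨n, hn, rfl, hn'⟩ := hB.exists_repr hβ
  refine Finset.sum_eq_zero fun a ha => ?_
  have h1 := hn' a (hn ha)
  rw [h a (hn ha)] at h1
  have h2 : n a = 0 := by exact_mod_cast h1.symm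
  simp [h2]

lemma IsSimpleSystem.exists_coord_pos (hB : IsSimpleSystem H B)
    (hβ : β ∈ AddSubmonoid.closure B) (h0 : β ≠ 0) : ∃ b ∈ B, 0 < hB.coord b β := by
  by_contra! h
  exact h0 (hB.eq_zero_of_coord hβ fun b hb => le_antisymm (h b hb) (hB.coord_nonneg hβ))

lemma IsSimpleSystem.neg_of_coord_neg (hB : IsSimpleSystem H B) (hβ : IsRoot H β)
    (h : hB.coord b β < 0) : -β ∈ AddSubmonoid.closure B := by
  refine (hB.pos_or_neg β hβ).resolve_left fun h' => ?_
  have := hB.coord_nonneg (b := b) h'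
  linarith

lemma IsSimpleSystem.one_le_height (hB : IsSimpleSystem H B)
    (hβ : β ∈ AddSubmonoid.closure B) (h0 : β ≠ 0) : 1 ≤ hB.height β := by
  induction hβ using AddSubmonoid.closure_induction with
  | mem x hx => rw [hB.height_apply hx]
  | zero => exact absurd rfl h0
  | add x y hx hy h1 h2 =>
    have hn : ∀ z ∈ AddSubmonoid.closure B, 0 ≤ hB.height z := fun z hz =>
      hB.functional_nonneg zero_le_one hz
    rw [map_add]
    by_cases hx0 : x = 0
    · have := h2 (by rintro rfl; exact h0 (by rw [hx0, add_zero]))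
      linarith [hn x hx]
    · linarith [h1 hx0, hn y hy]

/-- The coordinates of a root are integers of one sign; for a negative root, nonnegativity on Φ
means vanishing on Φ. -/
lemma IsSimpleSystem.mem_parabolicSet_iff (hB : IsSimpleSystem H B) (hΦ : Φ ⊆ B) :
    β ∈ parabolicSet H B Φ ↔ IsRoot H β ∧ ∀ b ∈ Φ, 0 ≤ hB.coord b β := by
  classical
  refine and_congr_right fun hβ => ⟨?_, fun h => ?_⟩
  · rintro ⟨n, hn, rfl, h⟩ b hb
    rw [Finsupp.sum, map_sum]
    refine Finset.sum_nonneg fun a ha => ?_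
    rw [map_zsmul]
    by_cases hab : a = b
    · subst hab
      rw [hB.coord_self (hn ha)]
      simpa using h a hb
    · rw [hB.coord_of_ne (hn ha) hab, smul_zero]
  · rcases hB.pos_or_neg β hβ with h1 | h1
    · obtain ⟨n, hn, hs, hn'⟩ := hB.exists_repr h1
      refine ⟨n.mapRange (fun k : ℕ => (k : ℤ)) rfl, ?_, ?_, ?_⟩
      · exact (Finset.coe_subset.2 Finsupp.support_mapRange).trans hn
      · rw [Finsupp.sum_mapRange_index (by simp)]
        simpa using hs
      · intro a _
        simp
    · obtain ⟨n, hn, hs, hn'⟩ := hB.exists_repr h1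
      refine ⟨n.mapRange (fun k : ℕ => -(k : ℤ)) (by simp), ?_, ?_, ?_⟩
      · exact (Finset.coe_subset.2 Finsupp.support_mapRange).trans hn
      · rw [Finsupp.sum_mapRange_index (by simp), ← neg_neg β, ← hs, Finsupp.sum, Finsupp.sum,
          ← Finset.sum_neg_distrib]
        simp
      · intro a ha
        have h2 := h a ha
        have h3 := hn' a (hΦ ha)
        rw [map_neg] at h3
        have h4 : (n a : ℝ) = 0 := le_antisymm (by linarith) (Nat.cast_nonneg _)
        have h5 : n a = 0 := by exact_mod_cast h4
        simp [h5]

/-- The difference would have coordinate -1 at γ and a positive one elsewhere. -/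
lemma IsSimpleSystem.not_isRoot_sub (hB : IsSimpleSystem H B) (hβ : IsRoot H β)
    (hβp : β ∈ AddSubmonoid.closure B) (hγ : γ ∈ B) (h : hB.coord γ β = 0) :
    ¬ IsRoot H (β - γ) := by
  intro hr
  have h1 := hB.neg_of_coord_neg (b := γ) hr (by rw [map_sub, h, hB.coord_self hγ]; norm_num)
  refine hβ.1 (hB.eq_zero_of_coord hβp fun b hb => ?_)
  by_cases hbγ : γ = b
  · rw [← hbγ, h]
  · have h2 := hB.coord_nonneg (b := b) h1
    rw [map_neg, map_sub, hB.coord_of_ne hγ hbγ] at h2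
    exact le_antisymm (by linarith) (hB.coord_nonneg hβp)

lemma IsSimpleSystem.not_isRoot_sub_of_mem (hB : IsSimpleSystem H B) (hδ : δ ∈ B) (hγ : γ ∈ B) :
    ¬ IsRoot H (δ - γ) := by
  by_cases h : δ = γ
  · exact fun hr => hr.1 (by rw [h, sub_self])
  · exact hB.not_isRoot_sub (hB.isRoot δ hδ) (AddSubmonoid.subset_closure hδ) hγ (hB.coord_of_ne hδ h)

lemma IsSimpleSystem.ne_neg_of_mem_closure (hB : IsSimpleSystem H B) (hβ : IsRoot H β)
    (hβp : β ∈ AddSubmonoid.closure B) (hγp : γ ∈ AddSubmonoid.closure B) : β ≠ -γ := by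
  rintro rfl
  obtain ⟨b, -, hb⟩ := hB.exists_coord_pos hβp hβ.1
  rw [map_neg] at hb
  linarith [hB.coord_nonneg (b := b) hγp]

variable [FiniteDimensional ℂ G] [LieAlgebra.IsKilling ℂ G]

/-- A simple root `γ` outside the support of the positive root `β` can be added to `β` if and only
if it is adjacent to the support of `β`. -/
lemma IsSimpleSystem.isRoot_add_iff (hB : IsSimpleSystem H B) (hβ : IsRoot H β)
    (hβp : β ∈ AddSubmonoid.closure B) (hγ : γ ∈ B) (h : hB.coord γ β = 0) :
    IsRoot H (β + γ) ↔ ∃ δ ∈ B, 0 < hB.coord δ β ∧ IsRoot H (δ + γ) := by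
  -- On the coroot of γ every simple root of the support takes a value ≤ 0, negative exactly when it
  -- is adjacent to γ. As β - γ is not a root, β + γ is one exactly when the weighted sum of these
  -- values is negative.
  obtain ⟨t, -, ht⟩ := (hB.isRoot γ hγ).exists_coroot
  have hγp := AddSubmonoid.subset_closure hγ
  obtain ⟨n, hn, hs, hn'⟩ := hB.exists_repr hβp
  obtain ⟨z, hz, -, hz2, hz3⟩ := ht β hβ
  have hsimple : ∀ δ ∈ B, δ ≠ γ → ∃ w : ℤ, δ t = w ∧ w ≤ 0 ∧ (w < 0 ↔ IsRoot H (δ + γ)) := by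
    intro δ hδ hne
    obtain ⟨w, hw, hw1, hw2, hw3⟩ := ht δ (hB.isRoot δ hδ)
    have hsub := hB.not_isRoot_sub_of_mem hδ hγ
    refine ⟨w, hw, not_lt.1 fun h0 => hsub (hw1 h0 hne), fun h0 => hw2 h0
      (hB.ne_neg_of_mem_closure (hB.isRoot δ hδ) (AddSubmonoid.subset_closure hδ) hγp), hw3 hsub⟩
  have hnγ : n γ = 0 := by
    have := hn' γ hγ
    rw [h] at this
    exact_mod_cast this.symm
  have hneγ : ∀ δ ∈ n.support, δ ≠ γ := fun δ hδ he => by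
    rw [he] at hδ; exact Finsupp.mem_support_iff.1 hδ hnγ
  choose! w hw hw0 hwr using hsimple
  have hsum : z = ∑ δ ∈ n.support, (n δ : ℤ) * w δ := by
    have h1 : β t = ∑ δ ∈ n.support, ((n δ : ℤ) * w δ : ℂ) := by
      rw [← hs, Finsupp.sum, LinearMap.sum_apply]
      refine Finset.sum_congr rfl fun δ hδ => ?_
      rw [LinearMap.smul_apply, hw δ (hn hδ) (hneγ δ hδ), nsmul_eq_mul, Int.cast_natCast]
    rw [hz] at h1
    exact_mod_cast h1
  have hle : ∀ δ ∈ n.support, (n δ : ℤ) * w δ ≤ 0 := fun δ hδ =>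
    mul_nonpos_of_nonneg_of_nonpos (Int.natCast_nonneg _) (hw0 δ (hn hδ) (hneγ δ hδ))
  have hpos : ∀ δ ∈ n.support, (0 : ℤ) < n δ := fun δ hδ => by
    have := Finsupp.mem_support_iff.1 hδ
    lia
  constructor
  · intro hr
    have hz0 : z < 0 := hz3 (hB.not_isRoot_sub hβ hβp hγ h) hr
    rw [hsum] at hz0
    obtain ⟨δ, hδ, hδ0⟩ := Finset.exists_lt_of_sum_lt (s := n.support)
      (f := fun δ => (n δ : ℤ) * w δ) (g := fun _ => 0) (by simpa using hz0)
    refine ⟨δ, hn hδ, ?_, (hwr δ (hn hδ) (hneγ δ hδ)).1 (by have := hpos δ hδ; nlinarith)⟩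
    rw [hn' δ (hn hδ)]
    exact_mod_cast hpos δ hδ
  · rintro ⟨δ, hδ, hδ0, hr⟩
    have hδs : δ ∈ n.support := by
      rw [hn' δ hδ] at hδ0
      have : 0 < n δ := by exact_mod_cast hδ0
      exact Finsupp.mem_support_iff.2 this.ne'
    have hneg := (hwr δ hδ (hneγ δ hδs)).2 hr
    refine hz2 ?_ (hB.ne_neg_of_mem_closure hβ hβp hγp)
    rw [hsum]
    exact Finset.sum_neg' hle ⟨δ, hδs, mul_neg_of_pos_of_neg (hpos δ hδs) hneg⟩

/-- A positive root that is not simple is the sum of a positive root and of a simple root. -/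
lemma IsSimpleSystem.exists_isRoot_sub (hB : IsSimpleSystem H B) (hβ : IsRoot H β)
    (hβp : β ∈ AddSubmonoid.closure B) (hβB : β ∉ B) :
    ∃ γ ∈ B, IsRoot H (β - γ) ∧ β - γ ∈ AddSubmonoid.closure B := by
  obtain ⟨t, ht2, ht⟩ := hβ.exists_coroot
  obtain ⟨n, hn, hs, hn'⟩ := hB.exists_repr hβp
  -- β takes the value 2 on its own coroot, so some simple root in its support is positive there.
  have key : ∃ γ ∈ n.support, ∃ z : ℤ, γ t = z ∧ 0 < z := by
    by_contra! hcon
    have : ∀ γ ∈ n.support, ∃ z : ℤ, γ t = z := fun γ hγ =>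
      let ⟨z, hz, _⟩ := ht γ (hB.isRoot γ (hn hγ)); ⟨z, hz⟩
    choose! w hw using this
    have h1 : β t = ∑ δ ∈ n.support, ((n δ : ℤ) * w δ : ℂ) := by
      rw [← hs, Finsupp.sum, LinearMap.sum_apply]
      refine Finset.sum_congr rfl fun δ hδ => ?_
      rw [LinearMap.smul_apply, hw δ hδ, nsmul_eq_mul, Int.cast_natCast]
    have h2 : (2 : ℤ) = ∑ δ ∈ n.support, (n δ : ℤ) * w δ := by
      rw [ht2] at h1
      exact_mod_cast h1
    have h3 : ∑ δ ∈ n.support, (n δ : ℤ) * w δ ≤ 0 := Finset.sum_nonpos fun δ hδ =>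
      mul_nonpos_of_nonneg_of_nonpos (Int.natCast_nonneg _) (hcon δ hδ _ (hw δ hδ))
    lia
  obtain ⟨γ, hγs, z, hz, hz0⟩ := key
  have hγ := hn hγs
  obtain ⟨z', hz', h1, -, -⟩ := ht γ (hB.isRoot γ hγ)
  obtain rfl : z = z' := by rw [hz] at hz'; exact_mod_cast hz'
  have hr : IsRoot H (β - γ) := by
    rw [← neg_sub, isRoot_neg_iff]
    exact h1 hz0 (fun h => hβB (h ▸ hγ))
  -- If β - γ were negative, β would have no coordinate besides the one at γ, which would be 1.
  refine ⟨γ, hγ, hr, (hB.pos_or_neg _ hr).resolve_right fun hneg => hβB ?_⟩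
  have hcoord : ∀ b ∈ B, b ≠ γ → n b = 0 := fun b hb hne => by
    have h3 := hB.coord_nonneg (b := b) hneg
    rw [map_neg, map_sub, hB.coord_of_ne hγ (Ne.symm hne), hn' b hb] at h3
    have h4 : (n b : ℝ) = 0 := le_antisymm (by linarith) (Nat.cast_nonneg _)
    exact_mod_cast h4
  have h5 := hB.coord_nonneg (b := γ) hneg
  rw [map_neg, map_sub, hB.coord_self hγ, hn' γ hγ] at h5
  have h6 : n γ ≤ 1 := by
    have : (n γ : ℝ) ≤ 1 := by linarith
    exact_mod_cast this
  have h7 : n γ = 1 := by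
    have := Finsupp.mem_support_iff.1 hγs
    lia
  rw [← hs, Finsupp.sum, Finset.sum_eq_single γ (fun b hb hne => by rw [hcoord b (hn hb) hne, zero_smul])
    (fun h => absurd hγs h), h7, one_smul]
  exact hγ

/-- The support of a positive root is connected. -/
lemma IsSimpleSystem.reachable_of_coord_pos (hB : IsSimpleSystem H B)
    {X : Set (Module.Dual ℂ H)} (hβ : IsRoot H β) (hβp : β ∈ AddSubmonoid.closure B)
    (hX : ∀ b ∈ B, 0 < hB.coord b β → b ∈ X) (hγ : γ ∈ B) (hδ : δ ∈ B)
    (hγX : γ ∈ X) (hδX : δ ∈ X)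
    (hγβ : 0 < hB.coord γ β) (hδβ : 0 < hB.coord δ β) :
    ((dynkinGraph H).induce X).Reachable ⟨γ, hγX⟩ ⟨δ, hδX⟩ := by
  obtain ⟨N, hN⟩ := exists_nat_gt (hB.height β)
  induction N generalizing β γ δ with
  | zero =>
    have := hB.one_le_height hβp hβ.1
    rw [Nat.cast_zero] at hN
    linarith
  | succ N ih =>
    by_cases hβB : β ∈ B
    · have hb : ∀ b, 0 < hB.coord b β → β = b := fun b h => by
        by_contra hne
        rw [hB.coord_of_ne hβB hne] at h
        exact lt_irrefl _ h
      obtain rfl := hb γ hγβ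
      obtain rfl := hb δ hδβ
      exact SimpleGraph.Reachable.refl _
    · obtain ⟨ε, hε, hr, hrp⟩ := hB.exists_isRoot_sub hβ hβp hβB
      have hcε : ∀ b ∈ B, b ≠ ε → hB.coord b (β - ε) = hB.coord b β := fun b _ hne => by
        rw [map_sub, hB.coord_of_ne hε (Ne.symm hne), sub_zero]
      have hX' : ∀ b ∈ B, 0 < hB.coord b (β - ε) → b ∈ X := fun b hb h => by
        refine hX b hb (h.trans_le ?_)
        rw [map_sub]
        linarith [hB.coord_nonneg (b := b) (AddSubmonoid.subset_closure hε)]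
      have hht : hB.height (β - ε) < N := by
        rw [map_sub, hB.height_apply hε]
        push_cast at hN
        linarith
      have hεβ : 0 < hB.coord ε β := by
        have := hB.coord_nonneg (b := ε) hrp
        rw [map_sub, hB.coord_self hε] at this
        linarith
      have hεX := hX ε hε hεβ
      -- The removed root ε either stays in the support of β - ε or is adjacent to it, since (β - ε)
      -- + ε is a root.
      have key : ∀ b (_ : b ∈ B) (hbX : b ∈ X), 0 < hB.coord b β →
          ((dynkinGraph H).induce X).Reachable ⟨ε, hεX⟩ ⟨b, hbX⟩ := by
        intro b hb hbX hbβ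
        by_cases hbε : b = ε
        · subst hbε
          exact SimpleGraph.Reachable.refl _
        have hb' : 0 < hB.coord b (β - ε) := by rwa [hcε b hb hbε]
        by_cases h0 : hB.coord ε (β - ε) = 0
        · obtain ⟨d, hd, hdβ, hdr⟩ := (hB.isRoot_add_iff hr hrp hε h0).1 (by rwa [sub_add_cancel])
          have hdX := hX' d hd hdβ
          have hadj : ((dynkinGraph H).induce X).Adj ⟨ε, hεX⟩ ⟨d, hdX⟩ := by
            refine ⟨fun (h : ε = d) => ?_, ?_⟩
            · rw [h] at h0
              rw [h] at hdβ
              linarith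
            · change IsRoot H (ε + d)
              rwa [add_comm]
          exact hadj.reachable.trans (ih hr hrp hX' hd hb hdX hbX hdβ hb' hht)
        · exact ih hr hrp hX' hε hb hεX hbX
            (lt_of_le_of_ne (hB.coord_nonneg hrp) (Ne.symm h0)) hb' hht
      exact (key γ hγ hγX hγβ).symm.trans (key δ hδ hδX hδβ)

/-- Growing a positive root along a walk in the Dynkin diagram. -/
lemma IsSimpleSystem.exists_isRoot_add (hB : IsSimpleSystem H B) {C : Set (Module.Dual ℂ H)}
    (hδ : δ ∈ B) {u v : (B \ C ∪ {δ} : Set (Module.Dual ℂ H))}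
    (h : ((dynkinGraph H).induce (B \ C ∪ {δ})).Reachable u v)
    (hβ : IsRoot H β) (hβp : β ∈ AddSubmonoid.closure B) (hβδ : 0 < hB.coord δ β)
    (hu : 0 < hB.coord u β) (hv : hB.coord v β = 0) :
    ∃ μ, IsRoot H μ ∧ μ ∈ AddSubmonoid.closure B ∧ (∀ c ∈ C, hB.coord c μ = 0) ∧
      0 < hB.coord v μ ∧ IsRoot H (β + μ) := by
  obtain ⟨w⟩ := h
  have hXB : ∀ x : (B \ C ∪ {δ} : Set (Module.Dual ℂ H)), (x : Module.Dual ℂ H) ∈ B := by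
    rintro ⟨x, hx | rfl⟩
    exacts [hx.1, hδ]
  have hXC : ∀ x : (B \ C ∪ {δ} : Set (Module.Dual ℂ H)), (x : Module.Dual ℂ H) ≠ δ →
      (x : Module.Dual ℂ H) ∉ C := by
    rintro ⟨x, hx | rfl⟩ h
    exacts [hx.2, absurd rfl h]
  induction w generalizing β with
  | nil => exact absurd hv hu.ne'
  | @cons u x v hadj p ih =>
    by_cases hx : 0 < hB.coord x β
    · exact ih hβ hβp hβδ hx hv
    have hx0 : hB.coord x β = 0 := le_antisymm (not_lt.1 hx) (hB.coord_nonneg hβp)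
    -- δ is already in the support, so a vertex new to the support differs from δ and hence avoids
    -- C.
    have hxδ : (x : Module.Dual ℂ H) ≠ δ := fun h => by rw [h] at hx0; linarith
    have hxr := hB.isRoot x (hXB x)
    have hxp := AddSubmonoid.subset_closure (hXB x)
    have hr : IsRoot H (β + x) := (hB.isRoot_add_iff hβ hβp (hXB x) hx0).2 ⟨u, hXB u, hu, hadj.2⟩
    have hxc : ∀ c ∈ C, hB.coord c x = 0 := fun c hc =>
      hB.coord_of_ne (hXB x) fun h => hXC x hxδ (h ▸ hc)
    by_cases hxv : x = v
    · subst hxv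
      exact ⟨x, hxr, hxp, hxc, by rw [hB.coord_self (hXB x)]; exact one_pos, hr⟩
    have hxv' : hB.coord v x = 0 := hB.coord_of_ne (hXB x) fun h => hxv (Subtype.ext h)
    obtain ⟨μ, hμ, hμp, hμC, hμv, hμr⟩ := ih hr (add_mem hβp hxp)
      (by rw [map_add]; linarith [hB.coord_nonneg (b := δ) hxp])
      (by rw [map_add, hx0, hB.coord_self (hXB x)]; norm_num)
      (by rw [map_add, hv, hxv', add_zero])
    -- The rest of the walk makes β + x + μ a root. Either μ can be added to β directly, or x + μ is
    -- a root and replaces μ.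
    rcases hβ.add_or_add hxr hμ hr hμr
      (fun h => hB.ne_neg_of_mem_closure hβ hβp hμp (eq_neg_of_add_eq_zero_left h))
      (fun h => hB.ne_neg_of_mem_closure hxr hxp hμp (eq_neg_of_add_eq_zero_left h)) with h | h
    · exact ⟨μ, hμ, hμp, hμC, hμv, h⟩
    · refine ⟨x + μ, h, add_mem hxp hμp, fun c hc => ?_, ?_, by rwa [← add_assoc]⟩
      · rw [map_add, hxc c hc, hμC c hc, add_zero]
      · rwa [map_add, hxv', zero_add]

end SimpleSystems

/-! ### The conjugation and the Levi chain for an arbitrary subalgebra q. -/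

section CRGeneral

variable {L : Type*} [LieRing L] [LieAlgebra ℝ L]

@[simp]
lemma conj_conj (Z : ℂ ⊗[ℝ] L) : conj L (conj L Z) = Z := by
  induction Z with
  | zero => simp
  | tmul w x => simp
  | add x y hx hy => rw [map_add, map_add, hx, hy]

lemma conj_lie (Z W : ℂ ⊗[ℝ] L) : conj L ⁅Z, W⁆ = ⁅conj L Z, conj L W⁆ := by
  induction W with
  | zero => rw [lie_zero Z, map_zero, lie_zero (conj L Z)]
  | tmul w' y =>
    induction Z with
    | zero => simp
    | tmul w x => simp
    | add a b ha hb => simp only [add_lie, map_add, ha, hb]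
  | add a b ha hb => rw [lie_add Z, map_add, map_add, lie_add (conj L Z), ha, hb]

variable {q : LieSubalgebra ℂ (ℂ ⊗[ℝ] L)} {Z W : ℂ ⊗[ℝ] L}

lemma mem_conjSub_iff : Z ∈ conjSub q ↔ conj L Z ∈ q := by
  constructor
  · rintro ⟨W, hW, rfl⟩
    rwa [conj_conj]
  · exact fun h => ⟨_, h, conj_conj Z⟩

lemma lie_mem_conjSub (hZ : Z ∈ conjSub q) (hW : W ∈ conjSub q) : ⁅Z, W⁆ ∈ conjSub q := by
  rw [mem_conjSub_iff] at *
  rw [conj_lie]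
  exact q.lie_mem hZ hW

lemma inf_le_leviChain (k : ℕ) : q.toSubmodule ⊓ conjSub q ≤ leviChain q k := by
  induction k with
  | zero => exact inf_le_left
  | succ k ih =>
    exact fun Z hZ => ⟨ih hZ, fun W hW => Submodule.mem_sup_right (lie_mem_conjSub hZ.2 hW)⟩

lemma IsLeviOneNondegenerate'.leviChain_one (h : IsLeviOneNondegenerate' q) :
    leviChain q 1 = q.toSubmodule ⊓ conjSub q := by
  refine le_antisymm (fun Z hZ => ⟨hZ.1, ?_⟩) (inf_le_leviChain 1)
  by_contra hZ'
  obtain ⟨W, hW, hZW⟩ := h Z hZ.1 hZ'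
  exact hZW (hZ.2 _ (mem_conjSub_iff.2 (by rwa [conj_conj])))

lemma IsLeviOneNondegenerate'.isLeviNondegenerate (h : IsLeviOneNondegenerate' q)
    (hq : ¬ IsTotallyReal q) : IsLeviNondegenerate q 1 := by
  have h1 := h.leviChain_one
  refine ⟨le_rfl, ?_, h1⟩
  rw [h1]
  exact lt_of_le_of_ne inf_le_left fun h2 => hq h2.symm

/-- For an intermediate subalgebra q', the space q ∩ σ(q') survives in every term of the chain. If
some term is q ∩ σ(q), the σ(q)-part of any element of q' lies in q. -/
lemma isFinitelyNondegenerate'_of_leviChain {k : ℕ}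
    (hk : leviChain q k = q.toSubmodule ⊓ conjSub q) : IsFinitelyNondegenerate' q := by
  intro q' hq hq'
  have hchain : ∀ m : ℕ, ∀ Z ∈ q, conj L Z ∈ q' → Z ∈ leviChain q m := by
    intro m
    induction m with
    | zero => exact fun Z hZ _ => hZ
    | succ m ih =>
      refine fun Z hZ hZ' => ⟨ih Z hZ hZ', fun W hW => ?_⟩
      have h1 : conj L ⁅Z, W⁆ ∈ q' := by
        rw [conj_lie]
        exact q'.lie_mem hZ' (hq (mem_conjSub_iff.1 hW))
      obtain ⟨a, ha, b, hb, hab⟩ := Submodule.mem_sup.1 (hq' h1)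
      have hb' : b ∈ q' := by
        rw [eq_sub_of_add_eq' hab]
        exact sub_mem h1 (hq ha)
      rw [← conj_conj ⁅Z, W⁆, ← hab, map_add, add_comm]
      refine Submodule.add_mem_sup (ih _ (mem_conjSub_iff.1 hb) (by rwa [conj_conj])) ?_
      exact mem_conjSub_iff.2 (by rwa [conj_conj])
  refine le_antisymm (fun X hX => ?_) hq
  obtain ⟨a, ha, b, hb, rfl⟩ := Submodule.mem_sup.1 (hq' hX)
  have hb' : b ∈ q' := by
    have := sub_mem hX (hq ha)
    rwa [add_sub_cancel_left] at this
  have h1 := hchain k _ (mem_conjSub_iff.1 hb) (by rwa [conj_conj])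
  rw [hk] at h1
  have h2 := mem_conjSub_iff.1 h1.2
  rw [conj_conj] at h2
  exact add_mem ha h2

end CRGeneral

/-! ### Detecting membership in a parabolic subalgebra by the Killing form. -/

section ParabolicMembership

open LieAlgebra LieAlgebra.IsKilling LieModule

variable {G : Type*} [LieRing G] [LieAlgebra ℂ G] [FiniteDimensional ℂ G]
  {H : LieSubalgebra ℂ G} [H.IsCartanSubalgebra] {B Φ Ψ : Set (Module.Dual ℂ H)}
  {α β γ : Module.Dual ℂ H}

lemma cartan_le_parabolic : H.toSubmodule ≤ (parabolic H B Φ).toSubmodule := le_sup_left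

lemma mem_parabolic_of_mem_rootSpace (hβ : β ∈ parabolicSet H B Φ) {x : G}
    (hx : x ∈ rootSpace H β) : x ∈ parabolic H B Φ :=
  Submodule.mem_sup_right (Submodule.mem_iSup_of_mem (⟨β, hβ⟩ : parabolicSet H B Φ) hx)

lemma parabolic_le_iff {S : Submodule ℂ G} : (parabolic H B Φ).toSubmodule ≤ S ↔
    H.toSubmodule ≤ S ∧ ∀ β ∈ parabolicSet H B Φ, ∀ x ∈ rootSpace H β, x ∈ S := by
  change (_ ⊔ _ ≤ S) ↔ _
  rw [sup_le_iff, iSup_le_iff]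
  exact and_congr_right fun _ => ⟨fun h β hβ x hx => h ⟨β, hβ⟩ hx, fun h β x hx => h β β.2 x hx⟩

lemma coe_mem_rootSpace_zero (h : H) : (h : G) ∈ rootSpace H (0 : Module.Dual ℂ H) := by
  have h1 : (h : G) ∈ rootSpace H (0 : H → ℂ) := by
    rw [rootSpace_zero_eq]
    exact h.2
  exact h1

lemma mem_of_mem_rootSpace_zero {x : G} (hx : x ∈ rootSpace H (0 : Module.Dual ℂ H)) : x ∈ H := by
  have h1 : x ∈ rootSpace H (0 : H → ℂ) := hx
  rwa [rootSpace_zero_eq] at h1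

lemma killingForm_eq_zero_of_add_ne_zero {x y : G} (hx : x ∈ rootSpace H α)
    (hy : y ∈ rootSpace H β) (h : α + β ≠ 0) : killingForm ℂ G x y = 0 :=
  killingForm_apply_eq_zero_of_mem_rootSpace_of_add_ne_zero ℂ G H hx hy
    fun h' => h (LinearMap.ext fun t => congrFun h' t)

/-- The root space of -β pairs nontrivially only with that of β, which is not among the summands of
the parabolic. -/
lemma killingForm_eq_zero_of_mem_parabolic (hβ : IsRoot H β) (hβΦ : β ∉ parabolicSet H B Φ)
    {x y : G} (hx : x ∈ parabolic H B Φ) (hy : y ∈ rootSpace H (-β : Module.Dual ℂ H)) :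
    killingForm ℂ G x y = 0 := by
  have h : (parabolic H B Φ).toSubmodule ≤ LinearMap.ker ((killingForm ℂ G).flip y) := by
    refine parabolic_le_iff.2 ⟨fun x hx => ?_, fun γ hγ x hx => ?_⟩
    · exact killingForm_eq_zero_of_add_ne_zero (coe_mem_rootSpace_zero ⟨x, hx⟩) hy
        (by simpa using hβ.1)
    · exact killingForm_eq_zero_of_add_ne_zero hx hy fun h => by
        rw [add_neg_eq_zero] at h
        exact hβΦ (h ▸ hγ)
  exact h hx

variable [IsKilling ℂ G]

lemma IsRoot.killingForm_ne_zero (hβ : IsRoot H β) {x y : G} (hx : x ∈ rootSpace H β) (hx0 : x ≠ 0)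
    (hy : y ∈ rootSpace H (-β : Module.Dual ℂ H)) (hy0 : y ≠ 0) : killingForm ℂ G x y ≠ 0 := by
  intro h0
  have h1 := mem_ker_killingForm_of_mem_rootSpace_of_forall_rootSpace_neg ℂ G H hx fun z hz => by
    obtain ⟨c, rfl⟩ := hβ.neg.exists_smul_eq hy hy0 hz
    rw [map_smul, h0, smul_zero]
  rw [ker_killingForm_eq_bot] at h1
  exact hx0 h1

/-- An element outside a parabolic subalgebra is detected, through the Killing form, by a root
outside the parabolic set. -/
lemma exists_killingForm_ne_zero_of_notMem_parabolic {Z : G} (hZ : Z ∉ parabolic H B Φ) :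
    ∃ β, IsRoot H β ∧ β ∉ parabolicSet H B Φ ∧
      ∀ y ∈ rootSpace H (-β : Module.Dual ℂ H), y ≠ 0 → killingForm ℂ G Z y ≠ 0 := by
  have htop : Z ∈ ⨆ w : Weight ℂ H G, (genWeightSpace G w).toSubmodule := by
    rw [← LieSubmodule.iSup_toSubmodule, iSup_genWeightSpace_eq_top']
    trivial
  obtain ⟨f, hf, rfl⟩ := (Submodule.mem_iSup_iff_exists_finsupp _ _).1 htop
  obtain ⟨w, hw, hwZ⟩ : ∃ w ∈ f.support, f w ∉ parabolic H B Φ := by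
    by_contra! h
    exact hZ (sum_mem h)
  have hroot : IsRoot H w.toLinear := by
    refine ⟨fun h0 => hwZ (cartan_le_parabolic (mem_of_mem_rootSpace_zero ?_)), w.2⟩
    rw [← h0]
    exact hf w
  refine ⟨w.toLinear, hroot, fun h => hwZ (mem_parabolic_of_mem_rootSpace h (hf w)),
    fun y hy hy0 => ?_⟩
  have h0 : f w ≠ 0 := fun h => hwZ (h ▸ zero_mem _)
  rw [Finsupp.sum, map_sum, LinearMap.sum_apply, Finset.sum_eq_single w]
  · exact hroot.killingForm_ne_zero (hf w) h0 hy hy0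
  · intro v _ hv
    refine killingForm_eq_zero_of_add_ne_zero (α := v.toLinear) (hf v) hy fun h => hv ?_
    rw [add_neg_eq_zero] at h
    exact Weight.ext fun t => LinearMap.congr_fun h t
  · intro h
    exact absurd hw h

end ParabolicMembership

/-! ### The conjugation on root spaces; absence of imaginary roots. -/

section Conjugation

open LieAlgebra LieAlgebra.IsKilling LieModule

variable {L : Type*} [LieRing L] [LieAlgebra ℝ L]
  {H : LieSubalgebra ℂ (ℂ ⊗[ℝ] L)} (hH : IsConjStable H) {α β γ : Module.Dual ℂ H}

lemma conjDual_apply (h : H) :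
    conjDual hH α h = starRingEnd ℂ (α ⟨conj L h, hH h h.2⟩) := rfl

@[simp]
lemma conjDual_conjDual (α : Module.Dual ℂ H) : conjDual hH (conjDual hH α) = α := by
  ext h
  simp [conjDual_apply]

@[simp]
lemma conjDual_add (α β : Module.Dual ℂ H) :
    conjDual hH (α + β) = conjDual hH α + conjDual hH β := by
  ext h
  simp [conjDual_apply]

@[simp]
lemma conjDual_neg (α : Module.Dual ℂ H) : conjDual hH (-α) = -conjDual hH α := by
  ext h
  simp [conjDual_apply]

@[simp]
lemma conjDual_zero : conjDual hH (0 : Module.Dual ℂ H) = 0 := by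
  ext h
  simp [conjDual_apply]

lemma IsSimpleOfComplexType.exists_complexStructure (hL : IsSimpleOfComplexType L) :
    ∃ J : L →ₗ[ℝ] L, (∀ x, J (J x) = -x) ∧ ∀ x y, ⁅J x, y⁆ = J ⁅x, y⁆ := by
  obtain ⟨j, hj, -⟩ := hL
  have hj' : ∀ (r : ℝ) (x : L), (r : ℂ) • x = r • x := hj
  refine ⟨{ toFun := fun x => Complex.I • x, map_add' := smul_add _, map_smul' := fun r x => ?_ },
    fun x => ?_, fun x y => smul_lie _ x y⟩
  · rw [RingHom.id_apply, ← hj', ← hj', smul_comm]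
  · change Complex.I • Complex.I • x = -x
    rw [smul_smul, Complex.I_mul_I, neg_smul, one_smul]

variable [FiniteDimensional ℝ L] [H.IsCartanSubalgebra] [IsKilling ℂ (ℂ ⊗[ℝ] L)]

/-- In the Killing case root spaces are genuine eigenspaces, so σ can be applied to the eigenvalue
equation. -/
lemma conj_mem_rootSpace {x : ℂ ⊗[ℝ] L} (hx : x ∈ rootSpace H α) :
    conj L x ∈ rootSpace H (conjDual hH α) := by
  refine mem_rootSpace_of_forall_lie fun h => ?_
  have h1 := IsRoot.lie_eq_smul hx ⟨conj L h, hH h h.2⟩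
  have h2 := congrArg (conj L) h1
  rw [conj_lie, conj_conj, map_smulₛₗ] at h2
  exact h2

lemma IsRoot.conjDual (hα : IsRoot H α) : IsRoot H (conjDual hH α) := by
  obtain ⟨x, hx, hx0⟩ := hα.exists_ne_zero
  refine isRoot_of_mem (fun h => hα.1 ?_) (conj_mem_rootSpace hH hx) fun h => hx0 ?_
  · rw [← conjDual_conjDual hH α, h, conjDual_zero]
  · rw [← conj_conj x, h, map_zero]

/-- If `L` is of the complex type, there are no imaginary roots. -/
lemma IsSimpleOfComplexType.not_isImaginary (hL : IsSimpleOfComplexType L) (hα : IsRoot H α) :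
    ¬ IsImaginary hH α := by
  intro him
  obtain ⟨J₀, hJ₀, hJl₀⟩ := hL.exists_complexStructure
  set J := J₀.baseChange ℂ with hJdef
  have hJJ : ∀ x, J (J x) = -x := fun x => by
    induction x with
    | zero => simp
    | tmul w x => simp [hJdef, hJ₀, TensorProduct.tmul_neg]
    | add x y hx hy => rw [map_add, map_add, hx, hy, neg_add]
  have hJl : ∀ x y, ⁅J x, y⁆ = J ⁅x, y⁆ := fun x y => by
    induction x with
    | zero => simp
    | tmul w x =>
      induction y with
      | zero => simp
      | tmul w' y => simp [hJdef, hJl₀]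
      | add a b ha hb => simp only [lie_add, map_add, ha, hb]
    | add a b ha hb => simp only [add_lie, map_add, ha, hb]
  have hJr : ∀ x y, ⁅x, J y⁆ = J ⁅x, y⁆ := fun x y => by
    rw [← lie_skew, hJl, ← map_neg, lie_skew]
  have hJc : ∀ x, conj L (J x) = J (conj L x) := fun x => by
    induction x with
    | zero => simp
    | tmul w x => simp [hJdef]
    | add x y hx hy => simp only [map_add, hx, hy]
  have hJroot : ∀ (β : Module.Dual ℂ H) (x), x ∈ rootSpace H β → J x ∈ rootSpace H β :=
    fun β x hx => mem_rootSpace_of_forall_lie fun h => by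
      rw [hJr, IsRoot.lie_eq_smul hx, map_smul]
  have hJH : ∀ h : H, J h ∈ H := fun h =>
    mem_of_mem_rootSpace_zero (hJroot 0 _ (coe_mem_rootSpace_zero h))
  obtain ⟨e, he, he0⟩ := hα.exists_ne_zero
  obtain ⟨c, hc⟩ := hα.exists_smul_eq he he0 (hJroot _ _ he)
  have hc2 : c * c = -1 := by
    have h1 := hJJ e
    rw [← hc, map_smul, ← hc, smul_smul, ← neg_one_smul ℂ e] at h1
    exact smul_left_injective ℂ he0 h1
  -- c² = -1 forces c = ±i.
  have hcc : starRingEnd ℂ c = -c := by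
    have h1 : (c - Complex.I) * (c + Complex.I) = 0 := by
      linear_combination hc2 - Complex.I_mul_I
    rcases mul_eq_zero.1 h1 with h | h
    · rw [sub_eq_zero.1 h, Complex.conj_I]
    · rw [eq_neg_of_add_eq_zero_left h, map_neg, Complex.conj_I]
  have hαJ : ∀ h : H, α ⟨J h, hJH h⟩ = c * α h := fun h => by
    have h1 := IsRoot.lie_eq_smul he ⟨J h, hJH h⟩
    have h2 := hJl h e
    rw [IsRoot.lie_eq_smul he, map_smul, ← hc, smul_smul] at h2
    change ⁅J (h : ℂ ⊗[ℝ] L), e⁆ = _ at h1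
    rw [h2] at h1
    rw [mul_comm]
    exact (smul_left_injective ℂ he0 h1).symm
  -- α(Jh) = c α(h), while σ(α)(Jh) = -c σ(α)(h); with σ(α) = -α these give c α(h) = 0.
  refine hα.1 (LinearMap.ext fun h => ?_)
  have h1 := LinearMap.congr_fun him ⟨J h, hJH h⟩
  have h2 := LinearMap.congr_fun him h
  rw [conjDual_apply, LinearMap.neg_apply] at h1 h2
  have h3 : (⟨conj L (J h), hH _ (hJH h)⟩ : H) =
      ⟨J (conj L h), hJH ⟨conj L h, hH h h.2⟩⟩ := Subtype.ext (hJc h)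
  have h4 := hαJ ⟨conj L h, hH h h.2⟩
  change starRingEnd ℂ (α ⟨conj L (J h), hH _ (hJH h)⟩) = _ at h1
  rw [h3, h4, map_mul, h2, hcc, hαJ] at h1
  have hc0 : c ≠ 0 := by rintro rfl; simp at hc2
  have h5 : c * α h = 0 := by linear_combination h1 / 2
  rw [LinearMap.zero_apply]
  exact (mul_eq_zero.1 h5).resolve_left hc0

end Conjugation

/-! ### The conjugation on simple roots, and the two implications on roots. -/

section SimpleSystemConj

open LieAlgebra LieAlgebra.IsKilling LieModule

variable {L : Type*} [LieRing L] [LieAlgebra ℝ L]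
  {H : LieSubalgebra ℂ (ℂ ⊗[ℝ] L)} [H.IsCartanSubalgebra]
  {hH : IsConjStable H} {B Φ : Set (Module.Dual ℂ H)} {α β γ b : Module.Dual ℂ H}

lemma conjDual_mem_positiveRoots (hB : IsSimpleSystem H B) (hS : IsSChamber hH B)
    (hI : ∀ α, IsRoot H α → ¬ IsImaginary hH α) (hα : α ∈ B) :
    conjDual hH α ∈ positiveRoots H B :=
  hS α ⟨hB.isRoot α hα, AddSubmonoid.subset_closure hα⟩ (hI α (hB.isRoot α hα))

/-- Each simple root goes to a positive root, of height at least 1, so σ cannot lower heights. -/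
lemma conjDual_mem_closure (hB : IsSimpleSystem H B) (hS : IsSChamber hH B)
    (hI : ∀ α, IsRoot H α → ¬ IsImaginary hH α) (hβ : β ∈ AddSubmonoid.closure B) :
    conjDual hH β ∈ AddSubmonoid.closure B ∧ hB.height β ≤ hB.height (conjDual hH β) := by
  induction hβ using AddSubmonoid.closure_induction with
  | mem x hx =>
    have h := conjDual_mem_positiveRoots hB hS hI hx
    exact ⟨h.2, by rw [hB.height_apply hx]; exact hB.one_le_height h.2 h.1.1⟩
  | zero => simp
  | add x y _ _ hx hy =>
    rw [conjDual_add, map_add, map_add]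
    exact ⟨add_mem hx.1 hy.1, add_le_add hx.2 hy.2⟩

variable [FiniteDimensional ℝ L] [IsKilling ℂ (ℂ ⊗[ℝ] L)]

lemma reachable_conjDual {X Y : Set (Module.Dual ℂ H)}
    (hXY : ∀ x ∈ X, conjDual hH x ∈ Y) {u v : X} (h : ((dynkinGraph H).induce X).Reachable u v) :
    ((dynkinGraph H).induce Y).Reachable ⟨conjDual hH u, hXY u u.2⟩ ⟨conjDual hH v, hXY v v.2⟩ :=
  h.map (⟨fun x => ⟨conjDual hH x, hXY x x.2⟩, fun {a b} hab => by
    refine ⟨fun (h : conjDual hH a = conjDual hH b) => hab.1 ?_, ?_⟩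
    · have := congrArg (conjDual hH) h
      rwa [conjDual_conjDual, conjDual_conjDual] at this
    · have := hab.2.conjDual hH
      rwa [conjDual_add] at this⟩ :
    (dynkinGraph H).induce X →g (dynkinGraph H).induce Y)

variable (hB : IsSimpleSystem H B) (hS : IsSChamber hH B)
  (hI : ∀ α, IsRoot H α → ¬ IsImaginary hH α)

include hB hS hI

/-- Without imaginary roots, the conjugation permutes the simple roots of an `S`-chamber. -/
lemma conjDual_mem (hα : α ∈ B) : conjDual hH α ∈ B := by
  have h := conjDual_mem_positiveRoots hB hS hI hα
  by_contra hn
  obtain ⟨γ, hγ, hr, hrp⟩ := hB.exists_isRoot_sub h.1 h.2 hn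
  -- A non-simple σ(α) has height at least 2, and applying σ once more would give α height at least
  -- 2.
  have h1 := hB.one_le_height hrp hr.1
  have h2 := (conjDual_mem_closure hB hS hI h.2).2
  rw [conjDual_conjDual, hB.height_apply hα] at h2
  rw [map_sub, hB.height_apply hγ] at h1
  linarith

lemma coord_conjDual (hb : b ∈ B) (hβ : IsRoot H β) :
    hB.coord (conjDual hH b) (conjDual hH β) = hB.coord b β := by
  have key : ∀ x ∈ AddSubmonoid.closure B,
      hB.coord (conjDual hH b) (conjDual hH x) = hB.coord b x := by
    intro x hx
    induction hx using AddSubmonoid.closure_induction with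
    | mem x hx =>
      by_cases h : x = b
      · rw [h, hB.coord_self (conjDual_mem hB hS hI hb), hB.coord_self hb]
      · rw [hB.coord_of_ne hx h, hB.coord_of_ne (conjDual_mem hB hS hI hx)]
        intro h'
        have := congrArg (conjDual hH) h'
        rw [conjDual_conjDual, conjDual_conjDual] at this
        exact h this
    | zero => simp
    | add x y _ _ hx hy => rw [conjDual_add, map_add, map_add, hx, hy]
  rcases hB.pos_or_neg β hβ with h | h
  · exact key β h
  · have := key _ h
    rwa [conjDual_neg, map_neg, map_neg, neg_inj] at this

lemma image_conjDual_subset (hΦ : Φ ⊆ B) : conjDual hH '' Φ ⊆ B := by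
  rintro _ ⟨a, ha, rfl⟩
  exact conjDual_mem hB hS hI (hΦ ha)

lemma conjDual_mem_parabolicSet (hΦ : Φ ⊆ B) (hβ : β ∈ parabolicSet H B Φ) :
    conjDual hH β ∈ parabolicSet H B (conjDual hH '' Φ) := by
  rw [hB.mem_parabolicSet_iff hΦ] at hβ
  rw [hB.mem_parabolicSet_iff (image_conjDual_subset hB hS hI hΦ)]
  refine ⟨hβ.1.conjDual hH, ?_⟩
  rintro _ ⟨a, ha, rfl⟩
  rw [coord_conjDual hB hS hI (hΦ ha) hβ.1]
  exact hβ.2 a ha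

lemma conjSub_parabolic_le (hΦ : Φ ⊆ B) :
    conjSub (parabolic H B Φ) ≤ (parabolic H B (conjDual hH '' Φ)).toSubmodule := by
  refine Submodule.map_le_iff_le_comap.2 (parabolic_le_iff.2 ⟨fun x hx => ?_, fun β hβ x hx => ?_⟩)
  · exact cartan_le_parabolic (hH x hx)
  · exact mem_parabolic_of_mem_rootSpace (conjDual_mem_parabolicSet hB hS hI hΦ hβ)
      (conj_mem_rootSpace hH hx)

lemma conjSub_parabolic (hΦ : Φ ⊆ B) :
    conjSub (parabolic H B Φ) = (parabolic H B (conjDual hH '' Φ)).toSubmodule := by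
  refine le_antisymm (conjSub_parabolic_le hB hS hI hΦ) fun x hx => ?_
  -- The reverse inclusion is the first one for σΦ, because σ² = 1.
  have h1 := conjSub_parabolic_le hB hS hI (image_conjDual_subset hB hS hI hΦ)
    (Submodule.mem_map_of_mem hx)
  have h2 : conjDual hH '' (conjDual hH '' Φ) = Φ := by
    rw [Set.image_image]
    simp
  rw [h2] at h1
  exact mem_conjSub_iff.2 h1

/-- With no black simple roots, the correction term σ(α) - ε(α) is zero. -/
lemma satakeInvolution_iff : SatakeInvolution hH B α β ↔ α ∈ B ∧ β = conjDual hH α := by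
  have hempty : {γ ∈ B | IsImaginary hH γ} = ∅ :=
    Set.eq_empty_of_forall_notMem fun γ hγ => hI γ (hB.isRoot γ hγ.1) hγ.2
  unfold SatakeInvolution
  rw [hempty, AddSubmonoid.closure_empty, AddSubmonoid.mem_bot, sub_eq_zero]
  constructor
  · rintro ⟨hα, -, h | h⟩
    · exact absurd h.1 (hI α (hB.isRoot α hα))
    · exact ⟨hα, h.2.2.symm⟩
  · rintro ⟨hα, rfl⟩
    have h1 := conjDual_mem hB hS hI hα
    exact ⟨hα, h1, Or.inr ⟨hI _ (hB.isRoot _ hα), hI _ (hB.isRoot _ h1), rfl⟩⟩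

/-- If `(g, q_Φ)` has no proper enlargement inside `q + σ(q)`, then `ε(φ°(α))` meets `Φ` for every
`α ∈ Φ`. -/
lemma exists_satakeInvolution_of_isFinitelyNondegenerate' (hΦ : Φ ⊆ B)
    (h : IsFinitelyNondegenerate' (parabolic H B Φ)) (hα : α ∈ Φ) :
    ∃ γ ∈ component H B Φ α, ∃ β ∈ Φ, SatakeInvolution hH B γ β := by
  by_contra hcon
  have hΨ : Φ \ {α} ⊆ B := Set.sdiff_subset.trans hΦ
  have hle : parabolic H B Φ ≤ parabolic H B (Φ \ {α}) := by
    refine parabolic_le_iff.2 ⟨cartan_le_parabolic, fun β hβ x hx =>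
      mem_parabolic_of_mem_rootSpace ?_ hx⟩
    rw [hB.mem_parabolicSet_iff hΦ] at hβ
    rw [hB.mem_parabolicSet_iff hΨ]
    exact ⟨hβ.1, fun b hb => hβ.2 b hb.1⟩
  have hle' : (parabolic H B (Φ \ {α})).toSubmodule ≤
      (parabolic H B Φ).toSubmodule ⊔ conjSub (parabolic H B Φ) := by
    refine parabolic_le_iff.2 ⟨cartan_le_parabolic.trans le_sup_left, fun β hβ x hx => ?_⟩
    rw [hB.mem_parabolicSet_iff hΨ] at hβ
    by_cases h0 : 0 ≤ hB.coord α β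
    · refine Submodule.mem_sup_left (mem_parabolic_of_mem_rootSpace ?_ hx)
      rw [hB.mem_parabolicSet_iff hΦ]
      refine ⟨hβ.1, fun b hb => ?_⟩
      by_cases hbα : b = α
      · rwa [hbα]
      · exact hβ.2 b ⟨hb, hbα⟩
    · rw [not_le] at h0
      rw [conjSub_parabolic hB hS hI hΦ]
      refine Submodule.mem_sup_right (mem_parabolic_of_mem_rootSpace ?_ hx)
      rw [hB.mem_parabolicSet_iff (image_conjDual_subset hB hS hI hΦ)]
      refine ⟨hβ.1, ?_⟩
      rintro _ ⟨b, hb, rfl⟩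
      by_contra hneg
      rw [not_le] at hneg
      have hbB := conjDual_mem hB hS hI (hΦ hb)
      -- β is negative at α, hence a negative root, and so vanishes on Φ∖{α}. The support of -β is
      -- then connected within φ°(α); containing σ(b) it would contradict the assumption.
      have hX : ∀ c ∈ B, 0 < hB.coord c (-β) → c ∈ B \ Φ ∪ {α} := fun c hc hc0 => by
        rw [map_neg] at hc0
        by_cases hcα : c = α
        · exact Or.inr hcα
        · exact Or.inl ⟨hc, fun hcΦ => by linarith [hβ.2 c ⟨hcΦ, hcα⟩]⟩
      have hαc : 0 < hB.coord α (-β) := by rw [map_neg]; linarith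
      have hbc : 0 < hB.coord (conjDual hH b) (-β) := by rw [map_neg]; linarith
      refine hcon ⟨conjDual hH b, ⟨hX α (hΦ hα) hαc, hX _ hbB hbc,
        hB.reachable_of_coord_pos hβ.1.neg (hB.neg_of_coord_neg hβ.1 h0) hX (hΦ hα) hbB _ _
          hαc hbc⟩, b, hb, ?_⟩
      rw [satakeInvolution_iff hB hS hI]
      exact ⟨hbB, (conjDual_conjDual hH b).symm⟩
  -- The enlargement is proper: it contains the root space of -α.
  have heq := h _ hle hle'
  have hαr := hB.isRoot α (hΦ hα)
  obtain ⟨x, hx, hx0⟩ := hαr.neg.exists_ne_zero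
  obtain ⟨y, hy, hy0⟩ := hαr.neg.neg.exists_ne_zero
  have hxq : x ∈ parabolic H B Φ := by
    rw [← heq]
    refine mem_parabolic_of_mem_rootSpace ((hB.mem_parabolicSet_iff hΨ).2 ⟨hαr.neg, ?_⟩) hx
    intro b hb
    rw [map_neg, hB.coord_of_ne (hΦ hα) (Ne.symm hb.2), neg_zero]
  refine hαr.neg.killingForm_ne_zero hx hx0 hy hy0
    (killingForm_eq_zero_of_mem_parabolic hαr.neg (fun hmem => ?_) hxq hy)
  have := ((hB.mem_parabolicSet_iff hΦ).1 hmem).2 α hα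
  rw [map_neg, hB.coord_self (hΦ hα)] at this
  linarith

/-- If `ε(φ°(α))` meets `Φ` for every `α ∈ Φ`, then `(g, q_Φ)` is Levi `1`-nondegenerate. -/
lemma isLeviOneNondegenerate'_of_satakeInvolution (hΦ : Φ ⊆ B)
    (h : ∀ α ∈ Φ, ∃ γ ∈ component H B Φ α, ∃ β ∈ Φ, SatakeInvolution hH B γ β) :
    IsLeviOneNondegenerate' (parabolic H B Φ) := by
  intro Z hZ hZ'
  have hΦ' := image_conjDual_subset hB hS hI hΦ
  rw [conjSub_parabolic hB hS hI hΦ] at hZ' ⊢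
  obtain ⟨α, hα, hαP, hαZ⟩ := exists_killingForm_ne_zero_of_notMem_parabolic hZ'
  have hαQ : α ∈ parabolicSet H B Φ := by
    by_contra hαQ
    obtain ⟨y, hy, hy0⟩ := hα.neg.exists_ne_zero
    exact hαZ y hy hy0 (killingForm_eq_zero_of_mem_parabolic hα hαQ hZ hy)
  rw [hB.mem_parabolicSet_iff hΦ] at hαQ
  -- α fails to be a root of σ(q) = q_{σΦ} because of a negative coordinate on σΦ; hence α is a
  -- negative root.
  obtain ⟨d, hd, hdα⟩ : ∃ d ∈ Φ, hB.coord (conjDual hH d) α < 0 := by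
    by_contra! hcon
    refine hαP ((hB.mem_parabolicSet_iff hΦ').2 ⟨hα, ?_⟩)
    rintro _ ⟨d, hd, rfl⟩
    exact hcon d hd
  have hαp := hB.neg_of_coord_neg hα hdα
  obtain ⟨γ, ⟨hdX, hγX, hreach⟩, b, hb, hγb⟩ := h d hd
  obtain ⟨hγB, rfl⟩ := (satakeInvolution_iff hB hS hI).1 hγb
  have hdB := conjDual_mem hB hS hI (hΦ hd)
  have hXY : ∀ x ∈ B \ Φ ∪ {d}, conjDual hH x ∈ B \ (conjDual hH '' Φ) ∪ {conjDual hH d} := by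
    rintro x (hx | rfl)
    · refine Or.inl ⟨conjDual_mem hB hS hI hx.1, ?_⟩
      rintro ⟨y, hy, hyx⟩
      have := congrArg (conjDual hH) hyx
      rw [conjDual_conjDual, conjDual_conjDual] at this
      exact hx.2 (this ▸ hy)
    · exact Or.inr rfl
  have hdpos : 0 < hB.coord (conjDual hH d) (-α) := by rw [map_neg]; linarith
  have hbzero : hB.coord (conjDual hH γ) (-α) = 0 := by
    refine le_antisymm ?_ (hB.coord_nonneg hαp)
    rw [map_neg]
    linarith [hαQ.2 _ hb]
  -- The walk from d to γ in (B∖Φ) ∪ {d} is transported by σ to one from σ(d) to σ(γ) ∈ Φ, along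
  -- which -α is grown.
  obtain ⟨μ, hμ, hμp, hμC, hμb, hμr⟩ := hB.exists_isRoot_add hdB
    (reachable_conjDual hXY hreach) hα.neg hαp hdpos hdpos hbzero
  obtain ⟨W, hW, hW0⟩ := hμ.neg.exists_ne_zero
  obtain ⟨y, hy, hy0⟩ := hμr.neg.neg.exists_ne_zero
  have hWq : W ∈ conjSub (parabolic H B Φ) := by
    rw [conjSub_parabolic hB hS hI hΦ]
    refine mem_parabolic_of_mem_rootSpace ((hB.mem_parabolicSet_iff hΦ').2 ⟨hμ.neg, ?_⟩) hW
    intro c hc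
    rw [map_neg, hμC c hc, neg_zero]
  refine ⟨conj L W, mem_conjSub_iff.1 hWq, ?_⟩
  rw [conj_conj]
  intro hmem
  obtain ⟨u, hu, v, hv, huv⟩ := Submodule.mem_sup.1 hmem
  have hku : killingForm ℂ (ℂ ⊗[ℝ] L) u y = 0 := by
    refine killingForm_eq_zero_of_mem_parabolic hμr.neg (fun hQ => ?_) hu hy
    have := ((hB.mem_parabolicSet_iff hΦ).1 hQ).2 _ hb
    rw [map_neg, map_add, hbzero] at this
    linarith
  have hkv : killingForm ℂ (ℂ ⊗[ℝ] L) v y = 0 := by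
    refine killingForm_eq_zero_of_mem_parabolic hμr.neg (fun hQ => ?_) hv hy
    have := ((hB.mem_parabolicSet_iff hΦ').1 hQ).2 _ ⟨d, hd, rfl⟩
    rw [map_neg, map_add, hμC _ ⟨d, hd, rfl⟩] at this
    linarith
  have hsum : -μ + - -(-α + μ) = -α := by abel
  have hWy : ⁅W, y⁆ ∈ rootSpace H (-α : Module.Dual ℂ H) := by
    have := lie_mem_rootSpace_add hW hy
    rwa [hsum] at this
  -- By invariance κ(⁅Z, W⁆, y) = κ(Z, ⁅W, y⁆), and ⁅W, y⁆ is a nonzero vector of root -α, which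
  -- detects Z; yet y is orthogonal to q + σ(q).
  refine hαZ _ hWy ?_ ?_
  · exact lie_ne_zero_of_isRoot_add hμ.neg hμr.neg.neg (by rw [hsum]; exact hα.neg) hW hW0 hy hy0
  · rw [← LieModule.traceForm_apply_lie_apply, ← huv, map_add, LinearMap.add_apply]
    exact (congrArg₂ (· + ·) hku hkv).trans (add_zero 0)

end SimpleSystemConj

end ParabolicCR

end

/-! ### The equivalences. -/

open scoped TensorProduct in
theorem mainTheorem5 {L : Type*} [LieRing L] [LieAlgebra ℝ L] [FiniteDimensional ℝ L]
    (hL : ParabolicCR.IsSimpleOfComplexType L)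
    (H : LieSubalgebra ℂ (ℂ ⊗[ℝ] L)) [H.IsCartanSubalgebra]
    (hH : ParabolicCR.IsConjStable H)
    (B : Set (Module.Dual ℂ H)) (hB : ParabolicCR.IsSimpleSystem H B)
    (hS : ParabolicCR.IsSChamber hH B)
    (Φ : Set (Module.Dual ℂ H)) (hΦ : Φ ⊆ B)
    (hmin : ParabolicCR.IsMinimal (ParabolicCR.parabolic H B Φ)) :
    (¬ ParabolicCR.IsTotallyReal (ParabolicCR.parabolic H B Φ) →
      [ParabolicCR.IsFinitelyNondegenerate (ParabolicCR.parabolic H B Φ),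
       ParabolicCR.IsLeviNondegenerate (ParabolicCR.parabolic H B Φ) 1,
       ∀ α ∈ Φ, ∃ γ ∈ ParabolicCR.component H B Φ α, ∃ β ∈ Φ,
         ParabolicCR.SatakeInvolution hH B γ β].TFAE) ∧
    [ParabolicCR.IsFinitelyNondegenerate' (ParabolicCR.parabolic H B Φ),
     ParabolicCR.IsLeviOneNondegenerate' (ParabolicCR.parabolic H B Φ),
     ∀ α ∈ Φ, ∃ γ ∈ ParabolicCR.component H B Φ α, ∃ β ∈ Φ,
       ParabolicCR.SatakeInvolution hH B γ β].TFAE := by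
  have := hL.hasTrivialRadical
  have : LieAlgebra.IsKilling ℂ (ℂ ⊗[ℝ] L) := ParabolicCR.isKilling_complexification
  have hI : ∀ α, ParabolicCR.IsRoot H α → ¬ ParabolicCR.IsImaginary hH α :=
    fun α hα => hL.not_isImaginary hH hα
  have h13 : ParabolicCR.IsFinitelyNondegenerate' (ParabolicCR.parabolic H B Φ) → ∀ α ∈ Φ,
      ∃ γ ∈ ParabolicCR.component H B Φ α, ∃ β ∈ Φ, ParabolicCR.SatakeInvolution hH B γ β :=
    fun h α hα => ParabolicCR.exists_satakeInvolution_of_isFinitelyNondegenerate' hB hS hI hΦ h hα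
  have h32 := ParabolicCR.isLeviOneNondegenerate'_of_satakeInvolution hB hS hI hΦ
  refine ⟨fun hT => ?_, ?_⟩
  -- Not being totally real serves only to make the inclusion q⁽¹⁾ ⊊ q strict.
  · tfae_have 3 → 2 := fun h => (h32 h).isLeviNondegenerate hT
    tfae_have 2 → 1 := fun h => ⟨1, h⟩
    tfae_have 1 → 3 := fun ⟨_, hk⟩ =>
      h13 (ParabolicCR.isFinitelyNondegenerate'_of_leviChain hk.2.2)
    tfae_finish
  · tfae_have 1 → 3 := h13
    tfae_have 3 → 2 := h32
    tfae_have 2 → 1 := fun h =>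
      ParabolicCR.isFinitelyNondegenerate'_of_leviChain h.leviChain_one
    tfae_finish
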